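/- **Setting.** All objects are smooth, $M$ is a (Hausdorff) manifold of dimension $n$, and vector fields may be defined on open subsets $U\subseteq M$. For a connection $\nabla$ on $TM$, $d_\nabla$ is the exterior covariant derivative on $TM$-valued forms: $(d_\nabla X)(Y)=\nabla_YX$ for a vector field $X$, and $(d_\nabla V)(X,Y)=\nabla_X(VY)-\nabla_Y(VX)-V[X,Y]$ for a $(1,1)$-tensor field $V$. Let $(M,\circ,e)$ be an $F$-manifold: $\circ$ is a commutative, associative product on $TM$ with unit field $e$ that satisfies the Hertling–Manin condition. Assume that it is semisimple, i.e. near every point there are canonical coordinates $u^1,\dots,u^n$ with $\partial_j\circ\partial_k=\delta_{jk}\partial_j$. Let $E$ be an eventual identity: $E$ is $\circ$-invertible and $X*Y:=X\circ Y\circ E^{-1}$ is again an $F$-manifold product (with unit $E$). Assume that the components of $E$ in canonical coordinates of $\circ$ are functionally independent (their differentials are linearly independent on a dense set). A connection $\nabla$ is *compatible* with a product $\circ$ if it is torsionless, $(\nabla_X\circ)(Y,Z)=(\nabla_Y\circ)(X,Z)$, and $Z\circ R(W,Y)X+W\circ R(Y,Z)X+Y\circ R(Z,W)X=0$. Let $\nabla^{(1)}$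 be a flat connection compatible with $\circ$ and $\nabla^{(2)}$ a flat connection compatible with $*$, and let them be *almost hydrodynamically equivalent*: $(d_{\nabla^{(1)}}-d_{\nabla^{(2)}})(X\circ)=0$ for every $X$, or $(d_{\nabla^{(1)}}-d_{\nabla^{(2)}})(X*)=0$ for every $X$. **Theorem (twisted Lenard–Magri chain).** 1. Let $X$ be a vector field on an open set $U$ with $[d_{\nabla^{(1)}}X,E\circ]=0$. Then $[d_{\nabla^{(2)}}(E\circ X),E\circ]=0$ and $d_{\nabla^{(1)}}d_{\nabla^{(2)}}(E\circ X)=0$ on $U$, and every solution $X'$ of $d_{\nabla^{(1)}}X'=d_{\nabla^{(2)}}(E\circ X)$ on $U$ again satisfies $[d_{\nabla^{(1)}}X',E\circ]=0$. 2. The recursion $$d_{\nabla^{(1)}}X_{(p+1,\alpha)}=d_{\nabla^{(2)}}\bigl(E\circ X_{(p,\alpha)}\bigr),\qquad p=0,1,2,\dots,\ \alpha=1,\dots,n,$$ started from a frame $(X_{(0,1)},\dots,X_{(0,n)})$ of $\nabla^{(1)}$-flat vector fields on an open set $U$, is well defined: every point of $U$ has an open neighbourhood $W\subseteq U$ on which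 $d_{\nabla^{(1)}}X'=d_{\nabla^{(2)}}(E\circ X)$ has a solution $X'$ for every vector field $X$ on $W$ with $[d_{\nabla^{(1)}}X,E\circ]=0$, and on which a complete chain $(X_{(p,\alpha)})_{p\ge 0}$ with the given start exists. 3. The Christoffel symbols $\Gamma^i_{ij}$ ($i\ne j$) of $\nabla^{(1)}$ in canonical coordinates of $\circ$ satisfy, for pairwise distinct $i,j,k$, the semi-Hamiltonian condition $\partial_i\Gamma^k_{kj}-\Gamma^k_{kj}\Gamma^j_{ij}+\Gamma^k_{ik}\Gamma^k_{kj}-\Gamma^k_{ik}\Gamma^i_{ij}=0$. For every chain on an open set $U$ as in 2, all $X_{(p,\alpha)}$ satisfy $[d_{\nabla^{(1)}}X_{(p,\alpha)},E\circ]=0$, $[d_{\nabla^{(2)}}(E\circ X_{(p,\alpha)}),E\circ]=0$ and $d_{\nabla^{(1)}}d_{\nabla^{(2)}}(E\circ X_{(p,\alpha)})=0$, and the systems $$u^i_{t_{(p,\alpha)}}=\bigl[d_{\nabla^{(2)}}(E\circ X_{(p-1,\alpha)})\bigr]^i_j\,u^j_x=\bigl(d_{\nabla^{(1)}}X_{(p,\alpha)}\bigr)^i_j\,u^j_x,\qquad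 p=1,2,3,\dots,$$ are flows of the semi-Hamiltonian hierarchy: in canonical coordinates of $\circ$ they are diagonal, $u^i_t=v^iu^i_x$, with $\partial_jv^i=\Gamma^i_{ij}(v^j-v^i)$ for $i\ne j$. These flows commute pairwise: for any two of them, with times $t$ and $\tau$, $u_{t\tau}=u_{\tau t}$ holds identically in $u,u_x,u_{xx}$. -/

import Mathlib

open scoped Manifold ContDiff Topology

noncomputable section

/-- Vector fields on an `n`-dimensional manifold `M` (no regularity built in). -/
abbrev VField (n : ℕ) (M : Type*) [TopologicalSpace M]
    [ChartedSpace (EuclideanSpace ℝ (Fin n)) M] :=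
  Π x : M, TangentSpace (𝓡 n) x

/-- Tensor fields of type `(1,1)`, i.e. `TM`-valued `1`-forms. -/
abbrev EndField (n : ℕ) (M : Type*) [TopologicalSpace M]
    [ChartedSpace (EuclideanSpace ℝ (Fin n)) M] :=
  Π x : M, TangentSpace (𝓡 n) x →L[ℝ] TangentSpace (𝓡 n) x

/-- Tensor fields of type `(1,2)`, i.e. bilinear products on the tangent spaces. -/
abbrev MulField (n : ℕ) (M : Type*) [TopologicalSpace M]
    [ChartedSpace (EuclideanSpace ℝ (Fin n)) M] :=
  Π x : M, TangentSpace (𝓡 n) x →L[ℝ] TangentSpace (𝓡 n) x →L[ℝ] TangentSpace (𝓡 n) x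

/-- Affine connections on `M`: covariant derivatives on the tangent bundle.
`D Y x (X x)` is `(∇_X Y)(x)`. -/
abbrev Conn (n : ℕ) (M : Type*) [TopologicalSpace M]
    [ChartedSpace (EuclideanSpace ℝ (Fin n)) M] [IsManifold (𝓡 n) ∞ M] :=
  CovariantDerivative (𝓡 n) (EuclideanSpace ℝ (Fin n)) (fun x : M ↦ TangentSpace (𝓡 n) x)

section

variable {n : ℕ} {M : Type*} [TopologicalSpace M] [ChartedSpace (EuclideanSpace ℝ (Fin n)) M]

/-- The product `X ∘ Y` of two vector fields. -/
def mulVF (c : MulField n M) (X Y : VField n M) : VField n M := fun x ↦ c x (X x) (Y x)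

/-- The product `X * Y = X ∘ Y ∘ E⁻¹`; here `Einv` is the `∘`-inverse `E⁻¹`. -/
def dualMul (c : MulField n M) (Einv : VField n M) : MulField n M := fun x ↦
  let B : EuclideanSpace ℝ (Fin n) →L[ℝ] EuclideanSpace ℝ (Fin n) →L[ℝ]
    EuclideanSpace ℝ (Fin n) := c x
  (ContinuousLinearMap.compL ℝ _ _ _ (B.flip (Einv x))) ∘L B

theorem dualMul_apply (c : MulField n M) (Einv : VField n M) (x : M)
    (u v : TangentSpace (𝓡 n) x) : dualMul c Einv x u v = c x (c x u v) (Einv x) := rfl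

variable [IsManifold (𝓡 n) ∞ M]

/-- The vector field `X` is smooth on the set `U`. -/
def SmoothVF (U : Set M) (X : VField n M) : Prop :=
  ContMDiffOn (𝓡 n) (𝓡 n).tangent ∞ (fun x ↦ (⟨x, X x⟩ : TangentBundle (𝓡 n) M)) U

/-- The `(1,1)`-tensor field `X ∘`. -/
def mulEnd (c : MulField n M) (X : VField n M) : EndField n M := fun x ↦ c x (X x)

/-- The value of a `(1,1)`-tensor field on a vector field. -/
def EndField.app (V : EndField n M) (X : VField n M) : VField n M := fun x ↦ V x (X x)

/-- `[A, B] = 0` on `U`, for `(1,1)`-tensor fields. -/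
def CommuteOn (U : Set M) (A B : EndField n M) : Prop :=
  ∀ x ∈ U, (A x) ∘L (B x) = (B x) ∘L (A x)

/-- The Lie bracket of vector fields. -/
def bracket (X Y : VField n M) : VField n M := VectorField.mlieBracket (𝓡 n) X Y

/-! ### Coordinates -/

/-- The coordinate vector field `∂_i` of the chart `φ` (used on `φ.source` only). -/
def coordField (φ : OpenPartialHomeomorph M (EuclideanSpace ℝ (Fin n))) (i : Fin n) :
    VField n M :=
  VectorField.mpullback (𝓡 n) (𝓡 n) φ
    (fun _ ↦ (EuclideanSpace.single i (1 : ℝ) : EuclideanSpace ℝ (Fin n)))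

/-- The `i`-th component in the chart `φ` of a tangent vector at `x`. -/
def coordComp (φ : OpenPartialHomeomorph M (EuclideanSpace ℝ (Fin n))) (i : Fin n) (x : M)
    (v : TangentSpace (𝓡 n) x) : ℝ :=
  (show EuclideanSpace ℝ (Fin n) from mfderiv (𝓡 n) (𝓡 n) φ x v) i

/-- The differential of a function at `x`. -/
def differential (f : M → ℝ) (x : M) : TangentSpace (𝓡 n) x →L[ℝ] ℝ :=
  mfderiv (𝓡 n) 𝓘(ℝ, ℝ) f x

/-- The partial derivative `∂_i f` with respect to the chart `φ`. -/
def partialD (φ : OpenPartialHomeomorph M (EuclideanSpace ℝ (Fin n))) (i : Fin n)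
    (f : M → ℝ) (x : M) : ℝ :=
  differential f x (coordField φ i x)

/-- `φ` is a system of canonical coordinates for `c`: a smooth chart in which
`c^i_{jk} = δ^i_j δ^i_k`. -/
def IsCanonicalChart (c : MulField n M)
    (φ : OpenPartialHomeomorph M (EuclideanSpace ℝ (Fin n))) : Prop :=
  φ ∈ IsManifold.maximalAtlas (𝓡 n) ∞ M ∧
    ∀ x ∈ φ.source, ∀ j k : Fin n,
      c x (coordField φ j x) (coordField φ k x) = if j = k then coordField φ j x else 0

/-- Semisimplicity: canonical coordinates exist around every point. -/
def IsSemisimple (c : MulField n M) : Prop :=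
  ∀ x : M, ∃ φ : OpenPartialHomeomorph M (EuclideanSpace ℝ (Fin n)),
    IsCanonicalChart c φ ∧ x ∈ φ.source

/-- The components of `E` in canonical coordinates are functionally independent: their
differentials are linearly independent at the points of a dense set. -/
def HasIndependentComponents (c : MulField n M) (E : VField n M) : Prop :=
  ∀ φ : OpenPartialHomeomorph M (EuclideanSpace ℝ (Fin n)), IsCanonicalChart c φ →
    φ.source ⊆ closure {x ∈ φ.source | LinearIndependent ℝ
      (fun i : Fin n ↦ differential (n := n) (fun y ↦ coordComp φ i y (E y)) x)}

/-- The matrix `V^i_j(u)` of a `(1,1)`-tensor field in the chart `φ`, as a function of the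
coordinates `u`. -/
def coordMatrix (φ : OpenPartialHomeomorph M (EuclideanSpace ℝ (Fin n))) (V : EndField n M)
    (u : EuclideanSpace ℝ (Fin n)) : EuclideanSpace ℝ (Fin n) →L[ℝ] EuclideanSpace ℝ (Fin n) :=
  (mfderiv (𝓡 n) (𝓡 n) φ (φ.symm u)) ∘L (V (φ.symm u)) ∘L
    (mfderiv (𝓡 n) (𝓡 n) φ (φ.symm u)).inverse

/-- For the system `u_t = V(u) u_x`, and with `u_τ = W(u) u_x`, the value of
`u_{tτ} = ∂_τ (V(u) u_x) = (dV(u)[u_τ]) u_x + V(u) (u_τ)_x` at a point of the jet space with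
coordinates `u`, `u_x = a`, `u_{xx} = b`. -/
def mixedDeriv
    (V W : EuclideanSpace ℝ (Fin n) →
      (EuclideanSpace ℝ (Fin n) →L[ℝ] EuclideanSpace ℝ (Fin n)))
    (u a b : EuclideanSpace ℝ (Fin n)) : EuclideanSpace ℝ (Fin n) :=
  (fderiv ℝ V u (W u a)) a + V u ((fderiv ℝ W u a) a + W u b)

/-- The flows `u_t = V(u) u_x` and `u_τ = W(u) u_x` on `U` commute: `u_{tτ} = u_{τt}` holds
identically in `u`, `u_x`, `u_{xx}`, in every system of coordinates. -/
def FlowsCommuteOn (U : Set M) (V W : EndField n M) : Prop :=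
  ∀ φ ∈ IsManifold.maximalAtlas (𝓡 n) ∞ M, ∀ u ∈ φ.target, φ.symm u ∈ U →
    ∀ a b : EuclideanSpace ℝ (Fin n),
      mixedDeriv (coordMatrix φ V) (coordMatrix φ W) u a b =
        mixedDeriv (coordMatrix φ W) (coordMatrix φ V) u a b

/-! ### `F`-manifolds and eventual identities -/

/-- `(M, c, e)` is an `F`-manifold with unit `e`: the product `c` is smooth, commutative,
associative, unital, and satisfies the Hertling–Manin condition. -/
structure IsFManifold (c : MulField n M) (e : VField n M) : Prop where
  smooth_mul : ContMDiff (𝓡 n)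
    ((𝓡 n).prod 𝓘(ℝ, EuclideanSpace ℝ (Fin n) →L[ℝ] EuclideanSpace ℝ (Fin n) →L[ℝ]
      EuclideanSpace ℝ (Fin n))) ∞
    (fun x ↦ Bundle.TotalSpace.mk'
      (EuclideanSpace ℝ (Fin n) →L[ℝ] EuclideanSpace ℝ (Fin n) →L[ℝ] EuclideanSpace ℝ (Fin n))
      (E := fun x : M ↦ TangentSpace (𝓡 n) x →L[ℝ] TangentSpace (𝓡 n) x →L[ℝ]
        TangentSpace (𝓡 n) x) x (c x))
  smooth_unit : SmoothVF Set.univ e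
  comm : ∀ (x : M) (u v : TangentSpace (𝓡 n) x), c x u v = c x v u
  assoc : ∀ (x : M) (u v w : TangentSpace (𝓡 n) x), c x (c x u v) w = c x u (c x v w)
  mul_unit : ∀ (x : M) (u : TangentSpace (𝓡 n) x), c x u (e x) = u
  hertling_manin : ∀ U : Set M, IsOpen U → ∀ X Y Z W : VField n M,
    SmoothVF U X → SmoothVF U Y → SmoothVF U Z → SmoothVF U W → ∀ x ∈ U,
      (bracket (mulVF c X Y) (mulVF c Z W)
        - mulVF c (bracket (mulVF c X Y) Z) W
        - mulVF c (bracket (mulVF c X Y) W) Z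
        - mulVF c X (bracket Y (mulVF c Z W))
        + mulVF c (mulVF c X (bracket Y Z)) W
        + mulVF c (mulVF c X (bracket Y W)) Z
        - mulVF c Y (bracket X (mulVF c Z W))
        + mulVF c (mulVF c Y (bracket X Z)) W
        + mulVF c (mulVF c Y (bracket X W)) Z) x = 0

/-- `E` is an eventual identity of the `F`-manifold `(M, c, e)`, with `∘`-inverse `Einv`:
the product `X * Y = X ∘ Y ∘ E⁻¹`, whose unit is `E`, defines a new `F`-manifold structure. -/
structure IsEventualIdentity (c : MulField n M) (e E Einv : VField n M) :
    Prop where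
  smooth : SmoothVF Set.univ E
  smooth_inv : SmoothVF Set.univ Einv
  mul_inv : ∀ x : M, c x (E x) (Einv x) = e x
  dual : IsFManifold (dualMul c Einv) E

/-! ### Connections -/

/-- The vector field `∇_X Y`. -/
def covD (D : Conn n M) (X Y : VField n M) : VField n M := fun x ↦ D Y x (X x)

/-- The exterior covariant derivative of a vector field (a `TM`-valued `0`-form):
`(d_∇ X)(Y) = ∇_Y X`. -/
def extD₀ (D : Conn n M) (X : VField n M) : EndField n M := fun x ↦ D X x

/-- The exterior covariant derivative of a `TM`-valued `1`-form:
`(d_∇ V)(X, Y) = ∇_X (V Y) - ∇_Y (V X) - V [X, Y]`. -/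
def extD₁ (D : Conn n M) (V : EndField n M) (X Y : VField n M) : VField n M :=
  covD D X (V.app Y) - covD D Y (V.app X) - V.app (bracket X Y)

/-- `d_∇ V = 0` on the open set `U`. -/
def IsExtClosedOn (D : Conn n M) (V : EndField n M) (U : Set M) : Prop :=
  ∀ W : Set M, IsOpen W → W ⊆ U → ∀ X Y : VField n M, SmoothVF W X → SmoothVF W Y →
    ∀ x ∈ W, extD₁ D V X Y x = 0

/-- The curvature `R(X, Y) Z`. -/
def curv (D : Conn n M) (X Y Z : VField n M) : VField n M :=
  covD D X (covD D Y Z) - covD D Y (covD D X Z) - covD D (bracket X Y) Z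

/-- The connection is flat: its curvature vanishes. -/
def IsFlat (D : Conn n M) : Prop :=
  ∀ U : Set M, IsOpen U → ∀ X Y Z : VField n M, SmoothVF U X → SmoothVF U Y → SmoothVF U Z →
    ∀ x ∈ U, curv D X Y Z x = 0

/-- The covariant derivative of the product: `(∇_X ∘)(Y, Z)`. -/
def covDMul (D : Conn n M) (c : MulField n M) (X Y Z : VField n M) : VField n M :=
  covD D X (mulVF c Y Z) - mulVF c (covD D X Y) Z - mulVF c Y (covD D X Z)

/-- The smooth connection `D` is compatible with the product `c`: it is torsionless,
`(∇_X ∘)(Y, Z) = (∇_Y ∘)(X, Z)`, and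
`Z ∘ R(W, Y) X + W ∘ R(Y, Z) X + Y ∘ R(Z, W) X = 0`. -/
structure IsCompatible (c : MulField n M) (D : Conn n M) : Prop where
  smooth : CovariantDerivative.ContMDiffCovariantDerivative D ∞
  torsionless : D.torsion = 0
  symm_mul : ∀ U : Set M, IsOpen U → ∀ X Y Z : VField n M,
    SmoothVF U X → SmoothVF U Y → SmoothVF U Z →
    ∀ x ∈ U, covDMul D c X Y Z x = covDMul D c Y X Z x
  curv_mul : ∀ U : Set M, IsOpen U → ∀ X Y Z W : VField n M,
    SmoothVF U X → SmoothVF U Y → SmoothVF U Z → SmoothVF U W → ∀ x ∈ U,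
      (mulVF c Z (curv D W Y X) + mulVF c W (curv D Y Z X) + mulVF c Y (curv D Z W X)) x = 0

/-- `(d_∇ - d_∇') (X ∘) = 0` for every (local) smooth vector field `X`. -/
def SameExtDOnMul (c : MulField n M) (D D' : Conn n M) : Prop :=
  ∀ U : Set M, IsOpen U → ∀ X : VField n M, SmoothVF U X →
    ∀ Y Z : VField n M, SmoothVF U Y → SmoothVF U Z →
      ∀ x ∈ U, (extD₁ D (mulEnd c X) Y Z - extD₁ D' (mulEnd c X) Y Z) x = 0

/-- `D` (compatible with `c`) and `D'` (compatible with `c'`) are almost hydrodynamically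
equivalent: `(d_∇ - d_∇') (X ∘) = 0` for all `X`, or `(d_∇ - d_∇') (X *) = 0` for all `X`. -/
def AlmostHydroEquiv (c c' : MulField n M) (D D' : Conn n M) : Prop :=
  SameExtDOnMul c D D' ∨ SameExtDOnMul c' D D'

/-! ### The semi-Hamiltonian hierarchy -/

/-- The Christoffel symbol `Γ^i_{jk}` in the chart `φ`: the `i`-th component of
`∇_{∂_j} ∂_k`. -/
def christoffel (D : Conn n M) (φ : OpenPartialHomeomorph M (EuclideanSpace ℝ (Fin n)))
    (i j k : Fin n) (x : M) : ℝ :=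
  coordComp φ i x (covD D (coordField φ j) (coordField φ k) x)

/-- In canonical coordinates the functions `Γ^i_{ij}`, `i ≠ j`, satisfy the semi-Hamiltonian
condition
`∂_i Γ^k_{kj} - Γ^k_{kj} Γ^j_{ij} + Γ^k_{ik} Γ^k_{kj} - Γ^k_{ik} Γ^i_{ij} = 0`
for pairwise distinct `i`, `j`, `k`. -/
def IsSemiHamiltonian (c : MulField n M) (D : Conn n M) : Prop :=
  ∀ φ : OpenPartialHomeomorph M (EuclideanSpace ℝ (Fin n)), IsCanonicalChart c φ →
    ∀ i j k : Fin n, i ≠ j → j ≠ k → k ≠ i → ∀ x ∈ φ.source,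
      partialD φ i (christoffel D φ k k j) x
        - christoffel D φ k k j x * christoffel D φ j i j x
        + christoffel D φ k i k x * christoffel D φ k k j x
        - christoffel D φ k i k x * christoffel D φ i i j x = 0

/-- The system `u_t = V(u) u_x` on `U` is a flow of the hierarchy defined by `(c, D)`: in
canonical coordinates it is diagonal, `u^i_t = v^i(u) u^i_x`, and
`∂_j v^i = Γ^i_{ij} (v^j - v^i)` for `i ≠ j`. -/
def IsHierarchyFlowOn (c : MulField n M) (D : Conn n M) (U : Set M) (V : EndField n M) : Prop :=
  ∀ φ : OpenPartialHomeomorph M (EuclideanSpace ℝ (Fin n)), IsCanonicalChart c φ →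
    ∃ v : Fin n → M → ℝ,
      (∀ i, ContMDiffOn (𝓡 n) 𝓘(ℝ, ℝ) ∞ (v i) (φ.source ∩ U)) ∧
      (∀ i, ∀ x ∈ φ.source ∩ U, V x (coordField φ i x) = v i x • coordField φ i x) ∧
      (∀ i j, i ≠ j → ∀ x ∈ φ.source ∩ U,
        partialD φ j (v i) x = christoffel D φ i i j x * (v j x - v i x))

/-! ### Twisted Lenard–Magri chains -/

/-- `(X 1, …, X n)` is a frame of flat vector fields on `U`. -/
structure IsFlatFrameOn (D : Conn n M) (U : Set M) (X : Fin n → VField n M) : Prop where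
  smooth : ∀ α, SmoothVF U (X α)
  flat : ∀ α, ∀ x ∈ U, extD₀ D (X α) x = 0
  frame : ∀ x ∈ U, LinearIndependent ℝ (fun α ↦ X α x)

/-- `X' ` is a next step after `X` on `U`: `d_{∇¹} X' = d_{∇²} (E ∘ X)`. -/
def IsTwistedStepOn (c : MulField n M) (E : VField n M) (D₁ D₂ : Conn n M) (U : Set M)
    (X X' : VField n M) : Prop :=
  SmoothVF U X' ∧ ∀ x ∈ U, extD₀ D₁ X' x = extD₀ D₂ (mulVF c E X) x

/-- `X_{(p,α)}` is a twisted Lenard–Magri chain on `U`: `(X_{(0,1)}, …, X_{(0,n)})` is a frame of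
`∇¹`-flat vector fields, and `d_{∇¹} X_{(p+1,α)} = d_{∇²} (E ∘ X_{(p,α)})`. -/
structure IsTwistedChainOn (c : MulField n M) (E : VField n M) (D₁ D₂ : Conn n M) (U : Set M)
    (X : ℕ → Fin n → VField n M) : Prop where
  start : IsFlatFrameOn D₁ U (X 0)
  step : ∀ p α, IsTwistedStepOn c E D₁ D₂ U (X p α) (X (p + 1) α)

end

end

/-! Everything is decided by the off-diagonal entries in canonical coordinates of `∘`. There both
products are diagonal: the unit has components `F^i = 1` for `∘` and `F^i = E^i` for `*`. The
Hertling–Manin condition for `*` forces `E^i` to depend on `u^i` alone (`DiagonalIn.fderiv_unit`).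
Torsion-freeness and the symmetry of `∇∘` give `Γ^l_{ij} = 0` for distinct indices and `F^i Γ^i_{ij}
+ F^j Γ^i_{jj} = 0` (`IsCompatible.localRep_gamma`), while almost hydrodynamic equivalence makes the
`Γ^l_{jk}` with `j ≠ k` agree (`SameExtDOnMul.gamma_eq`). Hence, for `i ≠ j`, the `(i,j)` entry of
`d_{∇¹} X` is `∂_j X^i + Γ^i_{ij} (X^i - X^j)`, and that of `d_{∇²}(E ∘ X)` is `E^i` times this.

Independence of the components gives `E^i ≠ E^j` on a dense set, so a smooth tensor field commuting
with `E ∘` is diagonal by continuity (`offdiag_of_commuteOn`). Thus the commutator condition on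
`d_{∇¹} X` makes `d_{∇²}(E ∘ X)` diagonal, that is, a multiplication `w ∘` (`isMulOn_extD₀_mulVF`).
On multiplications `d_{∇¹}` and `d_{∇²}` agree, so `d_{∇¹} d_{∇²}(E ∘ X) = d_{∇²} d_{∇²}(E ∘ X)`,
which is the curvature of `∇²` and vanishes (`isExtClosedOn_extD₀`).

Closed forms have local potentials by the Poincaré lemma in a flat frame (`exists_potential`), which
solves the recursion. Closed multiplications satisfy the equations of the hierarchy, and two closed
commuting tensor fields give commuting flows (`flowsCommuteOn_of_isExtClosedOn`). The
semi-Hamiltonian condition is one component of the vanishing curvature of `∇¹`. -/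

noncomputable section

set_option linter.unusedSectionVars false

/-! ### Vector fields and the Lie bracket in coordinates -/

section LocalRepresentation

/-- The model space `ℝⁿ`. -/
abbrev Coords (n : ℕ) := EuclideanSpace ℝ (Fin n)

variable {n : ℕ} {M : Type*} [TopologicalSpace M] [ChartedSpace (EuclideanSpace ℝ (Fin n)) M]

/-- The vector field `X` in the coordinates `φ`. -/
def localRep (φ : OpenPartialHomeomorph M (Coords n)) (X : VField n M) (u : Coords n) : Coords n :=
  mfderiv (𝓡 n) (𝓡 n) φ (φ.symm u) (X (φ.symm u))

/-- The vector field on `φ.source` with the coordinate expression `Z`. -/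
def ofLocal (φ : OpenPartialHomeomorph M (Coords n)) (Z : Coords n → Coords n) : VField n M :=
  fun x ↦ (mfderiv (𝓡 n) (𝓡 n) φ x).inverse (Z (φ x))

/-- The part of the coordinate domain of `φ` that corresponds to `U`. -/
def coordDomain (φ : OpenPartialHomeomorph M (Coords n)) (U : Set M) : Set (Coords n) :=
  φ.target ∩ φ.symm ⁻¹' U

theorem isOpen_coordDomain (φ : OpenPartialHomeomorph M (Coords n)) {U : Set M} (hU : IsOpen U) :
    IsOpen (coordDomain φ U) := φ.isOpen_inter_preimage_symm hU

theorem mem_coordDomain {φ : OpenPartialHomeomorph M (Coords n)} {U : Set M} {x : M}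
    (hx : x ∈ φ.source) (hxU : x ∈ U) : φ x ∈ coordDomain φ U :=
  ⟨φ.map_source hx, by simpa [φ.left_inv hx] using hxU⟩

theorem coordField_eq_ofLocal (φ : OpenPartialHomeomorph M (Coords n)) (i : Fin n) :
    coordField φ i = ofLocal φ (fun _ ↦ EuclideanSpace.single i 1) := rfl

variable [IsManifold (𝓡 n) ∞ M]

theorem SmoothVF.congr {U : Set M} {X Y : VField n M} (hX : SmoothVF U X)
    (h : ∀ x ∈ U, Y x = X x) : SmoothVF U Y :=
  ContMDiffOn.congr hX fun x hx ↦ by simp [h x hx]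

theorem SmoothVF.mono {U W : Set M} {X : VField n M} (hX : SmoothVF U X) (h : W ⊆ U) :
    SmoothVF W X := ContMDiffOn.mono hX h

theorem SmoothVF.mdifferentiableAt {U : Set M} {X : VField n M} (hU : IsOpen U)
    (hX : SmoothVF U X) {x : M} (hx : x ∈ U) :
    MDifferentiableAt (𝓡 n) (𝓡 n).tangent (fun x ↦ (⟨x, X x⟩ : TangentBundle (𝓡 n) M)) x :=
  (ContMDiffOn.contMDiffAt hX (hU.mem_nhds hx)).mdifferentiableAt (by simp)

section Chart

variable {φ : OpenPartialHomeomorph M (Coords n)} (hφ : φ ∈ IsManifold.maximalAtlas (𝓡 n) ∞ M)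

include hφ

theorem chart_mdifferentiable : φ.MDifferentiable (𝓡 n) (𝓡 n) :=
  ⟨(contMDiffOn_of_mem_maximalAtlas hφ).mdifferentiableOn (by simp),
    (contMDiffOn_symm_of_mem_maximalAtlas hφ).mdifferentiableOn (by simp)⟩

theorem chart_isInvertible {x : M} (hx : x ∈ φ.source) :
    (mfderiv (𝓡 n) (𝓡 n) φ x).IsInvertible :=
  ⟨(chart_mdifferentiable hφ).mfderiv hx, rfl⟩

theorem chart_symm_isInvertible {u : Coords n} (hu : u ∈ φ.target) :
    (mfderiv (𝓡 n) (𝓡 n) φ.symm u).IsInvertible :=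
  ⟨(chart_mdifferentiable hφ).symm.mfderiv hu, rfl⟩

theorem mfderiv_chart_inverse_apply {x : M} (hx : x ∈ φ.source) (v : Coords n) :
    mfderiv (𝓡 n) (𝓡 n) φ x ((mfderiv (𝓡 n) (𝓡 n) φ x).inverse v) = v :=
  (chart_isInvertible hφ hx).self_apply_inverse v

theorem inverse_mfderiv_chart_apply {x : M} (hx : x ∈ φ.source) (v : TangentSpace (𝓡 n) x) :
    (mfderiv (𝓡 n) (𝓡 n) φ x).inverse (mfderiv (𝓡 n) (𝓡 n) φ x v) = v :=
  (chart_isInvertible hφ hx).inverse_apply_self v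

theorem localRep_apply_chart (X : VField n M) {x : M} (hx : x ∈ φ.source) :
    localRep φ X (φ x) = mfderiv (𝓡 n) (𝓡 n) φ x (X x) := by
  -- The tangent space depends on the base point, so `φ.symm (φ x)` is generalised to a variable
  -- before it is identified with `x`.
  have h : ∀ y, y = x → (mfderiv (𝓡 n) (𝓡 n) φ y (X y) : Coords n) =
    mfderiv (𝓡 n) (𝓡 n) φ x (X x) := by rintro y rfl; rfl
  exact h _ (φ.left_inv hx)

theorem localRep_ofLocal (Z : Coords n → Coords n) {u : Coords n} (hu : u ∈ φ.target) :
    localRep φ (ofLocal φ Z) u = Z u := by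
  have h := mfderiv_chart_inverse_apply hφ (φ.map_target hu) (Z (φ (φ.symm u)))
  have h' : Z (φ (φ.symm u)) = Z u := by rw [φ.right_inv hu]
  exact h.trans h'

theorem mfderiv_chart_symm_apply {u : Coords n} (hu : u ∈ φ.target)
    (w : TangentSpace (𝓡 n) (φ.symm u)) :
    mfderiv (𝓡 n) (𝓡 n) φ.symm u (mfderiv (𝓡 n) (𝓡 n) φ (φ.symm u) w) = w := by
  have h := (chart_mdifferentiable hφ).symm.comp_symm_deriv (x := φ.symm u) (φ.map_target hu)
  have h' : ∀ u', u' = u →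
      (mfderiv (𝓡 n) (𝓡 n) φ.symm u').comp (mfderiv (𝓡 n) (𝓡 n) φ (φ.symm u)) =
        ContinuousLinearMap.id ℝ (TangentSpace (𝓡 n) (φ.symm u)) →
      mfderiv (𝓡 n) (𝓡 n) φ.symm u (mfderiv (𝓡 n) (𝓡 n) φ (φ.symm u) w) = w := by
    rintro u' rfl h
    exact congrArg (fun L ↦ L w) h
  exact h' _ (φ.right_inv hu) h

/-- Gives coordinate expressions access to the general facts on pullbacks: smoothness and naturality
of the Lie bracket. -/
theorem localRep_eq_mpullback (X : VField n M) {u : Coords n} (hu : u ∈ φ.target) :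
    localRep φ X u = VectorField.mpullback (𝓡 n) (𝓡 n) φ.symm X u := by
  have h := (chart_symm_isInvertible hφ hu).inverse_apply_self
    (mfderiv (𝓡 n) (𝓡 n) φ (φ.symm u) (X (φ.symm u)))
  rw [mfderiv_chart_symm_apply hφ hu] at h
  exact h.symm

/-- Smooth vector fields have smooth coordinate expressions. -/
theorem SmoothVF.contDiffOn {U : Set M} {X : VField n M} (hX : SmoothVF U X) :
    ContDiffOn ℝ ∞ (localRep φ X) (coordDomain φ U) := by
  have h : ContDiffOn ℝ ∞ (VectorField.mpullback (𝓡 n) (𝓡 n) φ.symm X) (coordDomain φ U) := by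
    intro u hu
    have h1 : ContMDiffAt (𝓡 n) (𝓡 n) ∞ φ.symm u := contMDiffAt_symm_of_mem_maximalAtlas hφ hu.1
    have h2 := ContMDiffWithinAt.mpullback_vectorField_preimage (m := ∞) (hX _ hu.2) h1
      (chart_symm_isInvertible hφ hu.1) (by simp)
    exact contMDiffWithinAt_vectorSpace_iff_contDiffWithinAt.1 (h2.mono Set.inter_subset_right)
  exact h.congr fun u hu ↦ localRep_eq_mpullback hφ X hu.1

theorem smoothVF_ofLocal {U : Set M} {Z : Coords n → Coords n}
    (hZ : ContDiffOn ℝ ∞ Z (coordDomain φ U)) : SmoothVF (φ.source ∩ U) (ofLocal φ Z) := by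
  intro x hx
  have h1 : ContMDiffAt (𝓡 n) (𝓡 n) ∞ φ x := contMDiffAt_of_mem_maximalAtlas hφ hx.1
  have h2 := contMDiffWithinAt_vectorSpace_iff_contDiffWithinAt.2 (hZ _ (mem_coordDomain hx.1 hx.2))
  have h3 := ContMDiffWithinAt.mpullback_vectorField_preimage (m := ∞) h2 h1
    (chart_isInvertible hφ hx.1) (by simp)
  exact h3.mono fun y hy ↦ mem_coordDomain hy.1 hy.2

theorem smoothVF_coordField (i : Fin n) : SmoothVF φ.source (coordField φ i) :=
  (smoothVF_ofLocal (U := Set.univ) hφ contDiffOn_const).mono fun _ hx ↦ ⟨hx, trivial⟩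

theorem localRep_coordField (i : Fin n) {u : Coords n} (hu : u ∈ φ.target) :
    localRep φ (coordField φ i) u = EuclideanSpace.single i 1 :=
  localRep_ofLocal hφ (fun _ ↦ EuclideanSpace.single i 1) hu

theorem coordComp_eq (X : VField n M) (i : Fin n) {x : M} (hx : x ∈ φ.source) :
    coordComp φ i x (X x) = localRep φ X (φ x) i := by
  rw [localRep_apply_chart hφ X hx]; rfl

/-- The Lie bracket in coordinates. -/
theorem localRep_bracket {U : Set M} {X Y : VField n M} (hU : IsOpen U) (hX : SmoothVF U X)
    (hY : SmoothVF U Y) {u : Coords n} (hu : u ∈ coordDomain φ U) :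
    localRep φ (bracket X Y) u = fderiv ℝ (localRep φ Y) u (localRep φ X u) -
      fderiv ℝ (localRep φ X) u (localRep φ Y u) := by
  have : IsManifold (𝓡 n) (minSmoothness ℝ 2) M := by simp; infer_instance
  have h1 : ContMDiffAt (𝓡 n) (𝓡 n) ∞ φ.symm u := contMDiffAt_symm_of_mem_maximalAtlas hφ hu.1
  have h2 := VectorField.mpullback_mlieBracket (hX.mdifferentiableAt hU hu.2)
    (hY.mdifferentiableAt hU hu.2) h1 (by
      rw [minSmoothness_of_isRCLikeNormedField]; exact WithTop.coe_le_coe.2 (le_top : (2 : ℕ∞) ≤ ⊤))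
  rw [localRep_eq_mpullback hφ _ hu.1]
  refine h2.trans ?_
  have e : ∀ Z : VField n M, VectorField.mpullback (𝓡 n) (𝓡 n) φ.symm Z =ᶠ[𝓝 u] localRep φ Z :=
    fun Z ↦ Filter.eventuallyEq_of_mem (φ.open_target.mem_nhds hu.1)
      fun v hv ↦ (localRep_eq_mpullback hφ Z hv).symm
  refine ((e X).mlieBracket_vectorField_eq (e Y)).trans ?_
  refine (congrFun VectorField.mlieBracketWithin_univ u).symm.trans ?_
  refine (congrFun VectorField.mlieBracketWithin_eq_lieBracketWithin u).trans ?_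
  refine (congrFun VectorField.lieBracketWithin_univ u).trans ?_
  rfl

end Chart

end LocalRepresentation

/-! ### Covariant derivatives and Christoffel symbols in coordinates -/

section Connections

theorem coords_eq_sum {n : ℕ} (a : Coords n) :
    a = ∑ k, a k • (EuclideanSpace.single k (1 : ℝ) : Coords n) := by
  ext i
  simp [Pi.single_apply]

variable {n : ℕ} {M : Type*} [TopologicalSpace M] [ChartedSpace (EuclideanSpace ℝ (Fin n)) M]

section

variable [IsManifold (𝓡 n) ∞ M]
variable {φ : OpenPartialHomeomorph M (Coords n)} (hφ : φ ∈ IsManifold.maximalAtlas (𝓡 n) ∞ M)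

include hφ

theorem hasMFDerivAt_comp_chart {g : Coords n → ℝ} {x : M} (hx : x ∈ φ.source)
    (hg : DifferentiableAt ℝ g (φ x)) :
    HasMFDerivAt (𝓡 n) 𝓘(ℝ, ℝ) (fun y ↦ g (φ y)) x
      ((fderiv ℝ g (φ x)).comp (mfderiv (𝓡 n) (𝓡 n) φ x : Coords n →L[ℝ] Coords n)) :=
  (hg.hasFDerivAt.hasMFDerivAt).comp x
    ((chart_mdifferentiable hφ).mdifferentiableAt hx).hasMFDerivAt

theorem differential_comp_chart {g : Coords n → ℝ} {x : M} (hx : x ∈ φ.source)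
    (hg : DifferentiableAt ℝ g (φ x)) (v : TangentSpace (𝓡 n) x) :
    differential (n := n) (fun y ↦ g (φ y)) x v =
      fderiv ℝ g (φ x) (mfderiv (𝓡 n) (𝓡 n) φ x v) := by
  unfold differential
  rw [(hasMFDerivAt_comp_chart hφ hx hg).mfderiv]; rfl

theorem differential_congr {f g : M → ℝ} {x : M} (h : f =ᶠ[𝓝 x] g) :
    differential (n := n) f x = differential g x := by
  unfold differential
  have := h.mfderiv_eq (I := 𝓡 n) (I' := 𝓘(ℝ, ℝ))
  ext v
  exact congrArg (fun L : Coords n →L[ℝ] ℝ ↦ L v) this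

end

variable [IsManifold (𝓡 n) ∞ M] (D : Conn n M)

/-- Locality of a covariant derivative is guaranteed only for fields differentiable at the point,
hence the smoothness assumption and the open set. -/
theorem conn_congr {U : Set M} (hU : IsOpen U) {X Y : VField n M} (hX : SmoothVF U X)
    (h : ∀ x ∈ U, X x = Y x) {x : M} (hx : x ∈ U) : D X x = D Y x :=
  D.isCovariantDerivativeOnUniv.congr_of_eventuallyEq (hX.mdifferentiableAt hU hx)
    ((hX.congr fun y hy ↦ (h y hy).symm).mdifferentiableAt hU hx) Filter.univ_mem
    (Filter.eventually_of_mem (hU.mem_nhds hx) h)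

theorem conn_sum {ι : Type*} (s : Finset ι) {X : ι → VField n M} {x : M}
    (hX : ∀ i, MDifferentiableAt (𝓡 n) (𝓡 n).tangent
      (fun x ↦ (⟨x, X i x⟩ : TangentBundle (𝓡 n) M)) x) :
    D (fun y ↦ ∑ i ∈ s, X i y) x = ∑ i ∈ s, D (X i) x := by
  classical
  induction s using Finset.induction_on with
  | empty => exact D.isCovariantDerivativeOnUniv.zero
  | insert a s ha ih =>
    have h1 : (fun y ↦ ∑ i ∈ insert a s, X i y) = X a + fun y ↦ ∑ i ∈ s, X i y := by
      ext1 y; simp [Finset.sum_insert ha]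
    rw [h1, D.isCovariantDerivativeOnUniv.add (hX a)
      (MDifferentiableAt.sum_section fun i _ ↦ hX i), ih, Finset.sum_insert ha]

theorem conn_smul {X : VField n M} {f : M → ℝ} {x : M} (hX : MDifferentiableAt (𝓡 n) (𝓡 n).tangent
      (fun x ↦ (⟨x, X x⟩ : TangentBundle (𝓡 n) M)) x) (hf : MDifferentiableAt (𝓡 n) 𝓘(ℝ, ℝ) f x)
    (v : TangentSpace (𝓡 n) x) :
    D (fun y ↦ f y • X y) x v = f x • D X x v + differential f x v • X x :=
  congrArg (fun L ↦ L v) (D.isCovariantDerivativeOnUniv.leibniz hX hf)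

/-- The Christoffel symbols of `D` in the chart `φ`, as a bilinear map: the first argument is the
vector that is differentiated. -/
def gamma (φ : OpenPartialHomeomorph M (Coords n)) (u : Coords n) :
    Coords n →L[ℝ] Coords n →L[ℝ] Coords n :=
  ∑ k, (EuclideanSpace.proj (𝕜 := ℝ) k).smulRight (coordMatrix φ (extD₀ D (coordField φ k)) u)

theorem gamma_apply (φ : OpenPartialHomeomorph M (Coords n)) (u a b : Coords n) :
    gamma D φ u a b = ∑ k, a k • coordMatrix φ (extD₀ D (coordField φ k)) u b := by
  simp [gamma]

section

variable {φ : OpenPartialHomeomorph M (Coords n)} (hφ : φ ∈ IsManifold.maximalAtlas (𝓡 n) ∞ M)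

include hφ

theorem coordMatrix_localRep (V : EndField n M) (Y : VField n M) {u : Coords n}
    (hu : u ∈ φ.target) : coordMatrix φ V u (localRep φ Y u) = localRep φ (V.app Y) u := by
  have h := inverse_mfderiv_chart_apply hφ (φ.map_target hu) (Y (φ.symm u))
  exact congrArg (fun w ↦ (mfderiv (𝓡 n) (𝓡 n) φ (φ.symm u) (V (φ.symm u) w) : Coords n)) h

theorem mfderiv_chart_coordField (k : Fin n) {x : M} (hx : x ∈ φ.source) :
    mfderiv (𝓡 n) (𝓡 n) φ x (coordField φ k x) = (EuclideanSpace.single k (1 : ℝ) : Coords n) :=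
  mfderiv_chart_inverse_apply hφ hx _

theorem vfield_eq_sum (X : VField n M) {x : M} (hx : x ∈ φ.source) :
    X x = ∑ k, localRep φ X (φ x) k • coordField φ k x := by
  apply (chart_mdifferentiable hφ).mfderiv_injective hx
  rw [map_sum]
  simp only [map_smul]
  simp only [mfderiv_chart_coordField hφ _ hx]
  rw [← localRep_apply_chart hφ X hx]
  exact coords_eq_sum _

/-- The covariant derivative in coordinates. -/
theorem coordMatrix_extD₀ {U : Set M} {X : VField n M} (hU : IsOpen U) (hX : SmoothVF U X)
    {u : Coords n} (hu : u ∈ coordDomain φ U) (b : Coords n) :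
    coordMatrix φ (extD₀ D X) u b =
      fderiv ℝ (localRep φ X) u b + gamma D φ u (localRep φ X u) b := by
  have hx : φ.symm u ∈ φ.source := φ.map_target hu.1
  have hU' : IsOpen (φ.source ∩ U) := φ.open_source.inter hU
  have hXd : DifferentiableAt ℝ (localRep φ X) u :=
    ((hX.contDiffOn hφ).contDiffAt ((isOpen_coordDomain φ hU).mem_nhds hu)).differentiableAt
      (by simp)
  have hXd' : DifferentiableAt ℝ (localRep φ X) (φ (φ.symm u)) := by rwa [φ.right_inv hu.1]
  have hXk : ∀ k, DifferentiableAt ℝ (fun w ↦ localRep φ X w k) (φ (φ.symm u)) := fun k ↦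
    (EuclideanSpace.proj (𝕜 := ℝ) k).differentiableAt.comp _ hXd'
  -- Near the point `X = ∑ X^k ∂_k`. Additivity and the Leibniz rule then split `∇X` into the
  -- differentials of the `X^k` and the terms collected in `gamma`.
  have h1 := conn_congr D hU' (hX.mono Set.inter_subset_right)
    (fun y hy ↦ vfield_eq_sum hφ X hy.1) ⟨hx, hu.2⟩
  have hk : ∀ k, MDifferentiableAt (𝓡 n) (𝓡 n).tangent
      (fun x ↦ (⟨x, coordField φ k x⟩ : TangentBundle (𝓡 n) M)) (φ.symm u) := fun k ↦
    (smoothVF_coordField hφ k).mdifferentiableAt φ.open_source hx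
  replace h1 := h1.trans (conn_sum D _ fun k ↦ MDifferentiableAt.smul_section
    (hasMFDerivAt_comp_chart hφ hx (hXk k)).mdifferentiableAt (hk k))
  have h2 : coordMatrix φ (extD₀ D X) u b =
      ∑ k, (localRep φ X u k • coordMatrix φ (extD₀ D (coordField φ k)) u b +
        fderiv ℝ (localRep φ X) u b k • (EuclideanSpace.single k (1 : ℝ) : Coords n)) := by
    refine (congrArg (fun L ↦ mfderiv (𝓡 n) (𝓡 n) φ (φ.symm u)
      (L ((mfderiv (𝓡 n) (𝓡 n) φ (φ.symm u)).inverse b))) h1).trans ?_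
    rw [sum_apply, map_sum]
    refine Finset.sum_congr rfl fun k _ ↦ ?_
    refine (congrArg _ (conn_smul D (hk k)
      (hasMFDerivAt_comp_chart hφ hx (hXk k)).mdifferentiableAt _)).trans ?_
    rw [differential_comp_chart hφ hx (hXk k), map_add, map_smul, map_smul,
      mfderiv_chart_coordField hφ k hx, φ.right_inv hu.1]
    have h3 : fderiv ℝ (fun w ↦ localRep φ X w k) u =
        (EuclideanSpace.proj (𝕜 := ℝ) k).comp (fderiv ℝ (localRep φ X) u) :=
      ((EuclideanSpace.proj (𝕜 := ℝ) k).hasFDerivAt.comp u hXd.hasFDerivAt).fderiv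
    exact congrArg₂ (· + ·) rfl (congrArg (· • (EuclideanSpace.single k (1 : ℝ) : Coords n))
      ((congrArg (fderiv ℝ (fun w ↦ localRep φ X w k) u)
        (mfderiv_chart_inverse_apply hφ hx b)).trans (congrArg (fun L ↦ L b) h3)))
  rw [h2, Finset.sum_add_distrib, ← coords_eq_sum, gamma_apply, add_comm]

theorem localRep_covD {U : Set M} {X : VField n M} (hU : IsOpen U) (hX : SmoothVF U X)
    (Y : VField n M) {u : Coords n} (hu : u ∈ coordDomain φ U) :
    localRep φ (covD D Y X) u =
      fderiv ℝ (localRep φ X) u (localRep φ Y u) + gamma D φ u (localRep φ X u) (localRep φ Y u) := by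
  rw [← coordMatrix_extD₀ D hφ hU hX hu, coordMatrix_localRep hφ _ _ hu.1]; rfl

end

end Connections

/-! ### Smoothness of tensor fields and their exterior derivatives in coordinates -/

section Smoothness

variable {n : ℕ} {M : Type*} [TopologicalSpace M] [ChartedSpace (EuclideanSpace ℝ (Fin n)) M]
  [IsManifold (𝓡 n) ∞ M]

/-- Smoothness of a connection is used through global sections, so a local field is first cut off by
a bump function. The Hausdorff property ensures that the extension by zero is smooth. -/
theorem SmoothVF.exists_global [T2Space M] {U : Set M} {X : VField n M} (hU : IsOpen U)
    (hX : SmoothVF U X) {x : M} (hx : x ∈ U) :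
    ∃ Y : VField n M, SmoothVF Set.univ Y ∧ ∃ W : Set M, IsOpen W ∧ x ∈ W ∧ W ⊆ U ∧
      ∀ y ∈ W, Y y = X y := by
  obtain ⟨f, -, hf⟩ := (SmoothBumpFunction.nhds_basis_tsupport (I := 𝓡 n) x).mem_iff.1
    (hU.mem_nhds hx)
  refine ⟨fun y ↦ f y • X y, contMDiffOn_univ.2 (ContMDiffOn.smul_section_of_tsupport
    (f.contMDiff.contMDiffOn) hU hf hX), ?_⟩
  obtain ⟨W, hWf, hW, hxW⟩ := eventually_nhds_iff.1 f.eventuallyEq_one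
  refine ⟨W ∩ U, hW.inter hU, ⟨hxW, hx⟩, Set.inter_subset_right, fun y hy ↦ ?_⟩
  simp [hWf y hy.1]

theorem smoothVF_of_locally {U : Set M} {X : VField n M}
    (h : ∀ x ∈ U, ∃ W : Set M, IsOpen W ∧ x ∈ W ∧ SmoothVF W X) : SmoothVF U X := by
  intro x hx
  obtain ⟨W, hW, hxW, hs⟩ := h x hx
  exact (ContMDiffOn.contMDiffAt hs (hW.mem_nhds hxW)).contMDiffWithinAt

theorem smoothVF_covD [T2Space M] {D : Conn n M}
    (hD : CovariantDerivative.ContMDiffCovariantDerivative D ∞) {U : Set M} {X Y : VField n M}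
    (hU : IsOpen U) (hX : SmoothVF U X) (hY : SmoothVF U Y) : SmoothVF U (covD D X Y) := by
  refine smoothVF_of_locally fun x hx ↦ ?_
  obtain ⟨Z, hZ, W, hW, hxW, hWU, hZW⟩ := hY.exists_global hU hx
  refine ⟨W, hW, hxW, ?_⟩
  have h1 := hD.contMDiff.contMDiff (σ := Z) hZ
  have h2 : SmoothVF W (covD D X Z) :=
    ContMDiffOn.clm_bundle_apply (h1.mono (Set.subset_univ W)) (hX.mono hWU)
  exact h2.congr fun y hy ↦ congrArg (fun L ↦ L (X y))
    (conn_congr D hW (hY.mono hWU) (fun z hz ↦ (hZW z hz).symm) hy)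

theorem smoothVF_mulVF {c : MulField n M} {e : VField n M} (hc : IsFManifold c e) {U : Set M}
    {X Y : VField n M} (hX : SmoothVF U X) (hY : SmoothVF U Y) : SmoothVF U (mulVF c X Y) :=
  ContMDiffOn.clm_bundle_apply₂ hc.smooth_mul.contMDiffOn hX hY

/-- The `(1,1)`-tensor field `V` is smooth on `U`: it maps smooth vector fields to smooth ones. -/
def SmoothEnd (U : Set M) (V : EndField n M) : Prop :=
  ∀ W : Set M, IsOpen W → W ⊆ U → ∀ X : VField n M, SmoothVF W X → SmoothVF W (V.app X)

theorem smoothEnd_extD₀ [T2Space M] {D : Conn n M}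
    (hD : CovariantDerivative.ContMDiffCovariantDerivative D ∞) {U : Set M} {X : VField n M}
    (hX : SmoothVF U X) : SmoothEnd U (extD₀ D X) :=
  fun _ hW hWU _ hY ↦ smoothVF_covD hD hW hY (hX.mono hWU)

theorem smoothEnd_mulEnd {c : MulField n M} {e : VField n M} (hc : IsFManifold c e) {U : Set M}
    {X : VField n M} (hX : SmoothVF U X) : SmoothEnd U (mulEnd c X) :=
  fun _ _ hWU _ hY ↦ smoothVF_mulVF hc (hX.mono hWU) hY

theorem SmoothEnd.mono {U W : Set M} {V : EndField n M} (hV : SmoothEnd U V) (h : W ⊆ U) :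
    SmoothEnd W V := fun W' hW' hWW' ↦ hV W' hW' (hWW'.trans h)

section Chart

variable {φ : OpenPartialHomeomorph M (Coords n)} (hφ : φ ∈ IsManifold.maximalAtlas (𝓡 n) ∞ M)

include hφ

theorem smoothVF_ofLocal_const (b : Coords n) : SmoothVF φ.source (ofLocal φ fun _ ↦ b) :=
  (smoothVF_ofLocal (U := Set.univ) hφ contDiffOn_const).mono fun _ hx ↦ ⟨hx, trivial⟩

theorem coordMatrix_apply (V : EndField n M) (b : Coords n) {u : Coords n} (hu : u ∈ φ.target) :
    coordMatrix φ V u b = localRep φ (V.app (ofLocal φ fun _ ↦ b)) u := by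
  rw [← coordMatrix_localRep hφ _ _ hu, localRep_ofLocal hφ _ hu]

/-- The columns of the matrix are the images of constant-coefficient fields. -/
theorem SmoothEnd.contDiffOn {U : Set M} {V : EndField n M} (hU : IsOpen U)
    (hV : SmoothEnd U V) : ContDiffOn ℝ ∞ (coordMatrix φ V) (coordDomain φ U) := by
  refine contDiffOn_clm_apply.2 fun b ↦ ?_
  have h := hV (φ.source ∩ U) (φ.open_source.inter hU) Set.inter_subset_right _
    ((smoothVF_ofLocal_const hφ b).mono Set.inter_subset_left)
  exact ((h.contDiffOn hφ).mono fun u hu ↦ ⟨hu.1, φ.map_target hu.1, hu.2⟩).congr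
    fun u hu ↦ coordMatrix_apply hφ V b hu.1

theorem contDiffOn_gamma [T2Space M] {D : Conn n M}
    (hD : CovariantDerivative.ContMDiffCovariantDerivative D ∞) :
    ContDiffOn ℝ ∞ (gamma D φ) φ.target := by
  refine contDiffOn_clm_apply.2 fun a ↦ ?_
  have h : ∀ k, ContDiffOn ℝ ∞ (coordMatrix φ (extD₀ D (coordField φ k))) φ.target := fun k ↦
    ((smoothEnd_extD₀ hD (smoothVF_coordField hφ k)).contDiffOn hφ φ.open_source).mono
      fun u hu ↦ ⟨hu, φ.map_target hu⟩
  have : (fun u ↦ gamma D φ u a) =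
      fun u ↦ ∑ k, a k • coordMatrix φ (extD₀ D (coordField φ k)) u := by
    ext1 u; ext1 b; rw [gamma_apply]; simp
  rw [this]
  exact ContDiffOn.sum fun k _ ↦ (h k).const_smul _

theorem fderiv_localRep_ofLocal_const (b : Coords n) {u : Coords n} (hu : u ∈ φ.target) :
    fderiv ℝ (localRep φ (ofLocal φ fun _ ↦ b)) u = 0 := by
  have : localRep φ (ofLocal φ fun _ ↦ b) =ᶠ[𝓝 u] fun _ ↦ b :=
    Filter.eventually_of_mem (φ.open_target.mem_nhds hu) fun v hv ↦ localRep_ofLocal hφ _ hv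
  rw [this.fderiv_eq]; simp

/-- Constant-coefficient fields serve as test fields throughout: they commute, so the bracket terms
in torsion, curvature and `extD₁` drop out. -/
theorem localRep_bracket_ofLocal_const (a b : Coords n) {u : Coords n} (hu : u ∈ φ.target) :
    localRep φ (bracket (ofLocal φ fun _ ↦ a) (ofLocal φ fun _ ↦ b)) u = 0 := by
  rw [localRep_bracket hφ φ.open_source (smoothVF_ofLocal_const hφ a) (smoothVF_ofLocal_const hφ b)
    ⟨hu, φ.map_target hu⟩, fderiv_localRep_ofLocal_const hφ _ hu,
    fderiv_localRep_ofLocal_const hφ _ hu]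
  simp

theorem localRep_covD_ofLocal_const (D : Conn n M) (a b : Coords n) {u : Coords n}
    (hu : u ∈ φ.target) :
    localRep φ (covD D (ofLocal φ fun _ ↦ b) (ofLocal φ fun _ ↦ a)) u = gamma D φ u a b := by
  rw [localRep_covD D hφ φ.open_source (smoothVF_ofLocal_const hφ a) _ ⟨hu, φ.map_target hu⟩,
    fderiv_localRep_ofLocal_const hφ _ hu, localRep_ofLocal hφ _ hu, localRep_ofLocal hφ _ hu]
  simp

theorem localRep_sub (X Y : VField n M) (u : Coords n) :
    localRep φ (X - Y) u = localRep φ X u - localRep φ Y u :=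
  map_sub (mfderiv (𝓡 n) (𝓡 n) φ (φ.symm u)) _ _

theorem localRep_eq_zero {X : VField n M} {u : Coords n} (h : X (φ.symm u) = 0) :
    localRep φ X u = 0 := by
  unfold localRep; rw [h, map_zero]; rfl

/-- A torsionless connection has symmetric Christoffel symbols. -/
theorem gamma_symm {D : Conn n M} (hD : D.torsion = 0) {u : Coords n} (hu : u ∈ φ.target)
    (a b : Coords n) : gamma D φ u a b = gamma D φ u b a := by
  have hx := φ.map_target hu
  have h := D.torsion_eq_zero_iff.1 hD
    ((smoothVF_ofLocal_const hφ b).mdifferentiableAt φ.open_source hx)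
    ((smoothVF_ofLocal_const hφ a).mdifferentiableAt φ.open_source hx)
  have h' : localRep φ (covD D (ofLocal φ fun _ ↦ b) (ofLocal φ fun _ ↦ a) -
      covD D (ofLocal φ fun _ ↦ a) (ofLocal φ fun _ ↦ b)) u = 0 :=
    (congrArg (mfderiv (𝓡 n) (𝓡 n) φ (φ.symm u)) h).trans
      (localRep_bracket_ofLocal_const hφ b a hu)
  rw [localRep_sub hφ, localRep_covD_ofLocal_const hφ D _ _ hu,
    localRep_covD_ofLocal_const hφ D _ _ hu] at h'
  exact sub_eq_zero.1 h'

/-- The exterior covariant derivative of a `(1,1)`-tensor field in coordinates. -/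
theorem localRep_extD₁ (D : Conn n M) {U : Set M} {V : EndField n M} (hU : IsOpen U)
    (hV : SmoothEnd U V) (a b : Coords n) {u : Coords n} (hu : u ∈ coordDomain φ U) :
    localRep φ (extD₁ D V (ofLocal φ fun _ ↦ a) (ofLocal φ fun _ ↦ b)) u =
      fderiv ℝ (coordMatrix φ V) u a b + gamma D φ u (coordMatrix φ V u b) a -
        (fderiv ℝ (coordMatrix φ V) u b a + gamma D φ u (coordMatrix φ V u a) b) := by
  have hU' := φ.open_source.inter hU
  have hu' : u ∈ coordDomain φ (φ.source ∩ U) := ⟨hu.1, φ.map_target hu.1, hu.2⟩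
  have hd : DifferentiableAt ℝ (coordMatrix φ V) u :=
    ((hV.contDiffOn hφ hU).contDiffAt ((isOpen_coordDomain φ hU).mem_nhds hu)).differentiableAt
      (by simp)
  have key : ∀ a b : Coords n,
      localRep φ (covD D (ofLocal φ fun _ ↦ a) (V.app (ofLocal φ fun _ ↦ b))) u =
        fderiv ℝ (coordMatrix φ V) u a b + gamma D φ u (coordMatrix φ V u b) a := by
    intro a b
    have hs := hV _ hU' Set.inter_subset_right _
      ((smoothVF_ofLocal_const hφ b).mono Set.inter_subset_left)
    rw [localRep_covD D hφ hU' hs _ hu', localRep_ofLocal hφ _ hu.1,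
      ← coordMatrix_apply hφ V b hu.1]
    have : localRep φ (V.app (ofLocal φ fun _ ↦ b)) =ᶠ[𝓝 u] fun v ↦ coordMatrix φ V v b :=
      Filter.eventually_of_mem (φ.open_target.mem_nhds hu.1)
        fun v hv ↦ (coordMatrix_apply hφ V b hv).symm
    rw [this.fderiv_eq, fderiv_clm_apply hd (differentiableAt_const b)]
    simp
  unfold extD₁
  rw [localRep_sub hφ, localRep_sub hφ, key, key, ← coordMatrix_localRep hφ _ _ hu.1,
    localRep_bracket_ofLocal_const hφ _ _ hu.1, map_zero, sub_zero]

/-- Closedness of a `(1,1)`-tensor field in coordinates. -/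
theorem IsExtClosedOn.fderiv_coordMatrix {D : Conn n M} {U : Set M} {V : EndField n M}
    (hU : IsOpen U) (hV : SmoothEnd U V) (hc : IsExtClosedOn D V U) (a b : Coords n)
    {u : Coords n} (hu : u ∈ coordDomain φ U) :
      fderiv ℝ (coordMatrix φ V) u a b + gamma D φ u (coordMatrix φ V u b) a =
        fderiv ℝ (coordMatrix φ V) u b a + gamma D φ u (coordMatrix φ V u a) b := by
  refine sub_eq_zero.1 ((localRep_extD₁ hφ D hU hV a b hu).symm.trans ?_)
  exact localRep_eq_zero hφ (hc (φ.source ∩ U) (φ.open_source.inter hU) Set.inter_subset_right _ _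
    ((smoothVF_ofLocal_const hφ a).mono Set.inter_subset_left)
    ((smoothVF_ofLocal_const hφ b).mono Set.inter_subset_left) _ ⟨φ.map_target hu.1, hu.2⟩)

end Chart

end Smoothness

/-! ### Potentials of closed tensor fields, and commuting flows -/

section Potentials

variable {n : ℕ} {M : Type*} [TopologicalSpace M] [ChartedSpace (EuclideanSpace ℝ (Fin n)) M]
  [IsManifold (𝓡 n) ∞ M]

theorem coordMatrix_injective {φ : OpenPartialHomeomorph M (Coords n)}
    (hφ : φ ∈ IsManifold.maximalAtlas (𝓡 n) ∞ M) {V V' : EndField n M} {x : M} (hx : x ∈ φ.source)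
    (h : coordMatrix φ V (φ x) = coordMatrix φ V' (φ x)) : V x = V' x := by
  have key : ∀ y, y ∈ φ.source → (mfderiv (𝓡 n) (𝓡 n) φ y ∘L V y ∘L
      (mfderiv (𝓡 n) (𝓡 n) φ y).inverse : Coords n →L[ℝ] Coords n) =
      (mfderiv (𝓡 n) (𝓡 n) φ y ∘L V' y ∘L (mfderiv (𝓡 n) (𝓡 n) φ y).inverse :
        Coords n →L[ℝ] Coords n) → V y = V' y := by
    intro y hy h
    ext v : 1
    apply (chart_mdifferentiable hφ).mfderiv_injective hy
    have h1 := congrArg (fun L ↦ L (mfderiv (𝓡 n) (𝓡 n) φ y v)) h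
    have h2 := inverse_mfderiv_chart_apply hφ hy v
    have h3 : ∀ V'' : EndField n M, (mfderiv (𝓡 n) (𝓡 n) φ y ∘L V'' y ∘L
      (mfderiv (𝓡 n) (𝓡 n) φ y).inverse : Coords n →L[ℝ] Coords n) (mfderiv (𝓡 n) (𝓡 n) φ y v)
      = mfderiv (𝓡 n) (𝓡 n) φ y (V'' y v) := fun V'' ↦
        congrArg (fun w ↦ mfderiv (𝓡 n) (𝓡 n) φ y (V'' y w)) h2
    exact (h3 V).symm.trans (h1.trans (h3 V'))
  have := key (φ.symm (φ x)) (φ.map_target (φ.map_source hx)) h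
  rwa [φ.left_inv hx] at this

theorem isInvertible_of_injective (L : Coords n →L[ℝ] Coords n) (h : Function.Injective L) :
    L.IsInvertible :=
  ⟨(LinearEquiv.ofInjectiveEndo L.toLinearMap h).toContinuousLinearEquiv, by ext; rfl⟩

/-- Closed `TM`-valued forms on a convex coordinate domain with a flat frame, in coordinates:
if the columns of `L` are parallel and `V` is closed, then `V` is the covariant derivative of some
vector field `Z`. -/
theorem exists_local_potential {s : Set (Coords n)} (hs : Convex ℝ s) (hso : IsOpen s)
    {Γ : Coords n → Coords n →L[ℝ] Coords n →L[ℝ] Coords n}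
    {L V : Coords n → Coords n →L[ℝ] Coords n} (hL : ContDiffOn ℝ ∞ L s) (hV : ContDiffOn ℝ ∞ V s)
    (hinj : ∀ u ∈ s, Function.Injective (L u))
    (hflat : ∀ u ∈ s, ∀ a b, fderiv ℝ L u b a + Γ u (L u a) b = 0)
    (hclosed : ∀ u ∈ s, ∀ a b, fderiv ℝ V u a b + Γ u (V u b) a =
      fderiv ℝ V u b a + Γ u (V u a) b) :
    ∃ Z : Coords n → Coords n, ContDiffOn ℝ ∞ Z s ∧
      ∀ u ∈ s, ∀ b, fderiv ℝ Z u b + Γ u (Z u) b = V u b := by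
  have hinv : ∀ u ∈ s, (L u).IsInvertible := fun u hu ↦ isInvertible_of_injective _ (hinj u hu)
  -- `Θ` holds the coefficients of `V` in the parallel frame `L`. Since the frame is parallel,
  -- covariant closedness of `V = L Θ` becomes ordinary closedness of `Θ`.
  set Θ : Coords n → Coords n →L[ℝ] Coords n := fun u ↦ (L u).inverse ∘L V u with hΘdef
  have hΘ : ContDiffOn ℝ ∞ Θ s := by
    intro u hu
    exact ((hinv u hu).contDiffAt_map_inverse.comp_contDiffWithinAt u (hL u hu)).clm_comp (hV u hu)
  have hLd : ∀ u ∈ s, DifferentiableAt ℝ L u := fun u hu ↦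
    (hL.contDiffAt (hso.mem_nhds hu)).differentiableAt (by simp)
  have hΘd : ∀ u ∈ s, DifferentiableAt ℝ Θ u := fun u hu ↦
    (hΘ.contDiffAt (hso.mem_nhds hu)).differentiableAt (by simp)
  have hVL : ∀ u ∈ s, V u = L u ∘L Θ u := by
    intro u hu
    ext1 b
    exact ((hinv u hu).self_apply_inverse (V u b)).symm
  have hVd : ∀ u ∈ s, ∀ a b, fderiv ℝ V u a b = fderiv ℝ L u a (Θ u b) + L u (fderiv ℝ Θ u a b) := by
    intro u hu a b
    have : V =ᶠ[𝓝 u] fun v ↦ L v ∘L Θ v := Filter.eventually_of_mem (hso.mem_nhds hu) hVL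
    rw [this.fderiv_eq, fderiv_clm_comp (hLd u hu) (hΘd u hu)]
    simp [add_comm]
  -- Poincaré lemma on the convex set `s`, followed by `Z = L H`: the derivative of `L` cancels
  -- against the connection term.
  obtain ⟨H, hH⟩ := hs.exists_forall_hasFDerivAt_of_fderiv_symmetric hso
    (fun u hu ↦ (hΘd u hu).differentiableWithinAt) (fun u hu a b ↦ by
      apply hinj u hu
      have h1 := hclosed u hu a b
      have h2 := hflat u hu (Θ u b) a
      have h3 := hflat u hu (Θ u a) b
      rw [hVd u hu, hVd u hu, hVL u hu] at h1
      simp only [ContinuousLinearMap.comp_apply] at h1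
      rw [add_right_comm, h2, add_right_comm, h3, zero_add, zero_add] at h1
      exact h1)
  have hHs : ContDiffOn ℝ ∞ H s := (contDiffOn_infty_iff_fderiv_of_isOpen hso).2
    ⟨fun u hu ↦ (hH u hu).differentiableAt.differentiableWithinAt,
      hΘ.congr fun u hu ↦ (hH u hu).fderiv⟩
  refine ⟨fun u ↦ L u (H u), hL.clm_apply hHs, fun u hu b ↦ ?_⟩
  rw [fderiv_clm_apply (hLd u hu) (hH u hu).differentiableAt, (hH u hu).fderiv, hVL u hu]
  have := hflat u hu (H u) b
  simp only [add_apply, ContinuousLinearMap.comp_apply,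
    ContinuousLinearMap.flip_apply]
  rw [add_assoc, this, add_zero]

/-- The order of quantifiers matters: `W` corresponds to a coordinate ball chosen from `U` and `x`
before `V`. It need not shrink from one step of the recursion to the next. -/
theorem exists_potential [T2Space M] {D : Conn n M} {U : Set M} (hU : IsOpen U)
    {X₀ : Fin n → VField n M} (hX₀ : IsFlatFrameOn D U X₀) {x : M} (hx : x ∈ U) :
    ∃ W : Set M, IsOpen W ∧ x ∈ W ∧ W ⊆ U ∧ ∀ V : EndField n M, SmoothEnd W V →
      IsExtClosedOn D V W → ∃ X' : VField n M, SmoothVF W X' ∧ ∀ y ∈ W, extD₀ D X' y = V y := by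
  set φ := chartAt (EuclideanSpace ℝ (Fin n)) x with hφdef
  have hφ : φ ∈ IsManifold.maximalAtlas (𝓡 n) ∞ M := IsManifold.chart_mem_maximalAtlas x
  have hxs : x ∈ φ.source := mem_chart_source _ x
  obtain ⟨r, hr, hball⟩ := Metric.isOpen_iff.1 (isOpen_coordDomain φ hU) _ (mem_coordDomain hxs hx)
  set s := Metric.ball (φ x) r with hsdef
  set W : Set M := φ.source ∩ φ ⁻¹' s with hWdef
  have hWU : W ⊆ U := fun y hy ↦ by
    have := (hball hy.2).2
    simpa [φ.left_inv hy.1] using this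
  have hsW : coordDomain φ W = s := by
    ext u
    constructor
    · rintro ⟨h1, h2, h3⟩
      simpa [φ.right_inv h1] using h3
    · intro hu
      have h1 := (hball hu).1
      exact ⟨h1, φ.map_target h1, by simpa [φ.right_inv h1] using hu⟩
  have hW : IsOpen W := φ.isOpen_inter_preimage Metric.isOpen_ball
  refine ⟨W, hW, ⟨hxs, Metric.mem_ball_self hr⟩, hWU, fun V hV hc ↦ ?_⟩
  -- The columns of `L` are the flat frame fields in coordinates.
  set L : Coords n → Coords n →L[ℝ] Coords n := fun u ↦
    ∑ α, (EuclideanSpace.proj (𝕜 := ℝ) α).smulRight (localRep φ (X₀ α) u) with hLdef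
  have hLa : ∀ u a, L u a = ∑ α, a α • localRep φ (X₀ α) u := fun u a ↦ by simp [hLdef]
  have hXs : ∀ α, ContDiffOn ℝ ∞ (localRep φ (X₀ α)) s := fun α ↦
    ((hX₀.smooth α).contDiffOn hφ).mono hball
  have hL : ContDiffOn ℝ ∞ L s := by
    refine contDiffOn_clm_apply.2 fun a ↦ ?_
    simp only [hLa]
    exact ContDiffOn.sum fun α _ ↦ (hXs α).const_smul _
  have hinj : ∀ u ∈ s, Function.Injective (L u) := by
    intro u hu
    rw [injective_iff_map_eq_zero]
    intro a ha
    have h1 : ∑ α, a α • X₀ α (φ.symm u) = 0 := by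
      apply (chart_mdifferentiable hφ).mfderiv_injective (φ.map_target (hball hu).1)
      rw [map_sum, map_zero]
      simp only [map_smul]
      exact (hLa u a).symm.trans ha
    have h2 := Fintype.linearIndependent_iff.1 (hX₀.frame _ (hball hu).2) _ h1
    ext α
    exact h2 α
  have hflat : ∀ u ∈ s, ∀ a b, fderiv ℝ L u b a + gamma D φ u (L u a) b = 0 := by
    intro u hu a b
    have hLd : DifferentiableAt ℝ L u :=
      (hL.contDiffAt (Metric.isOpen_ball.mem_nhds hu)).differentiableAt (by simp)
    have h1 : fderiv ℝ L u b a = ∑ α, a α • fderiv ℝ (localRep φ (X₀ α)) u b := by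
      have h2 : fderiv ℝ (fun v ↦ L v a) u b = fderiv ℝ L u b a := by
        rw [fderiv_clm_apply hLd (differentiableAt_const a)]; simp
      have h3 : ∀ α, DifferentiableAt ℝ (localRep φ (X₀ α)) u := fun α ↦
        ((hXs α).contDiffAt (Metric.isOpen_ball.mem_nhds hu)).differentiableAt (by simp)
      rw [← h2]
      simp only [hLa]
      rw [(HasFDerivAt.fun_sum fun α _ ↦ (h3 α).hasFDerivAt.fun_const_smul (a α)).fderiv]
      simp
    rw [h1, hLa, map_sum, sum_apply, ← Finset.sum_add_distrib]
    refine Finset.sum_eq_zero fun α _ ↦ ?_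
    rw [map_smul, smul_apply, ← smul_add,
      ← coordMatrix_extD₀ D hφ hU (hX₀.smooth α) (hball hu) b]
    have h4 : extD₀ D (X₀ α) (φ.symm u) = 0 := hX₀.flat α _ (hball hu).2
    have h5 : coordMatrix φ (extD₀ D (X₀ α)) u b = 0 := by
      unfold coordMatrix
      rw [h4]; exact map_zero (mfderiv (𝓡 n) (𝓡 n) φ (φ.symm u))
    rw [h5, smul_zero]
  obtain ⟨Z, hZ, hZV⟩ := exists_local_potential (s := s) (convex_ball _ _) Metric.isOpen_ball hL
    (hsW ▸ hV.contDiffOn hφ hW) hinj hflat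
    (fun u hu a b ↦ hc.fderiv_coordMatrix hφ hW hV a b (hsW ▸ hu))
  have hZs : SmoothVF W (ofLocal φ Z) := (smoothVF_ofLocal hφ (hsW.symm ▸ hZ)).mono
    fun y hy ↦ ⟨hy.1, hy⟩
  refine ⟨ofLocal φ Z, hZs, fun y hy ↦ coordMatrix_injective hφ hy.1 ?_⟩
  ext1 b
  have hys : φ y ∈ s := hy.2
  have hev : localRep φ (ofLocal φ Z) =ᶠ[𝓝 (φ y)] Z := Filter.eventually_of_mem
    (φ.open_target.mem_nhds (φ.map_source hy.1)) fun v hv ↦ localRep_ofLocal hφ Z hv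
  rw [coordMatrix_extD₀ D hφ hW hZs (hsW.symm ▸ hys), hev.fderiv_eq, hev.eq_of_nhds, hZV _ hys]

/-- The flows of two commuting closed `(1,1)`-tensor fields commute. -/
theorem flowsCommuteOn_of_isExtClosedOn {D : Conn n M} (hD : D.torsion = 0) {U : Set M}
    (hU : IsOpen U) {V W : EndField n M} (hV : SmoothEnd U V) (hW : SmoothEnd U W)
    (hVc : IsExtClosedOn D V U) (hWc : IsExtClosedOn D W U) (hVW : CommuteOn U V W) :
    FlowsCommuteOn U V W := by
  intro φ hφ u hu huU a b
  have hu' : u ∈ coordDomain φ U := ⟨hu, huU⟩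
  have hnh := (isOpen_coordDomain φ hU).mem_nhds hu'
  have hVd := ((hV.contDiffOn hφ hU).contDiffAt hnh).differentiableAt (by simp)
  have hWd := ((hW.contDiffOn hφ hU).contDiffAt hnh).differentiableAt (by simp)
  have hcomm : ∀ v ∈ coordDomain φ U, coordMatrix φ V v ∘L coordMatrix φ W v =
      coordMatrix φ W v ∘L coordMatrix φ V v := by
    intro v hv
    have key : ∀ V W : EndField n M, coordMatrix φ V v ∘L coordMatrix φ W v =
        coordMatrix φ (fun y ↦ V y ∘L W y) v := by
      intro V W
      ext1 b
      exact congrArg (fun w ↦ (mfderiv (𝓡 n) (𝓡 n) φ (φ.symm v) (V (φ.symm v) w) : Coords n))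
        (inverse_mfderiv_chart_apply hφ (φ.map_target hv.1) _)
    rw [key, key]
    exact congrArg (fun A ↦ (mfderiv (𝓡 n) (𝓡 n) φ (φ.symm v) ∘L A ∘L
      (mfderiv (𝓡 n) (𝓡 n) φ (φ.symm v)).inverse : Coords n →L[ℝ] Coords n)) (hVW _ hv.2)
  -- The derivative of `V W = W V` in the direction `a`, applied to `a`.
  have hd : fderiv ℝ (coordMatrix φ V) u a (coordMatrix φ W u a) +
      coordMatrix φ V u (fderiv ℝ (coordMatrix φ W) u a a) =
      fderiv ℝ (coordMatrix φ W) u a (coordMatrix φ V u a) +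
      coordMatrix φ W u (fderiv ℝ (coordMatrix φ V) u a a) := by
    have h1 : (fun v ↦ coordMatrix φ V v ∘L coordMatrix φ W v) =ᶠ[𝓝 u]
        fun v ↦ coordMatrix φ W v ∘L coordMatrix φ V v := Filter.eventually_of_mem hnh hcomm
    have h2 := h1.fderiv_eq (𝕜 := ℝ)
    rw [fderiv_clm_comp hVd hWd, fderiv_clm_comp hWd hVd] at h2
    have h3 := congrArg (fun L : Coords n →L[ℝ] Coords n →L[ℝ] Coords n ↦ L a a) h2
    simpa [add_comm] using h3
  have hb : coordMatrix φ V u (coordMatrix φ W u b) = coordMatrix φ W u (coordMatrix φ V u b) :=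
    congrArg (fun L ↦ L b) (hcomm u hu')
  have ha : coordMatrix φ V u (coordMatrix φ W u a) = coordMatrix φ W u (coordMatrix φ V u a) :=
    congrArg (fun L ↦ L a) (hcomm u hu')
  -- Closedness trades `dV[W a] a` for `dV[a](W a)` plus Christoffel terms, and likewise for `W`. By
  -- the symmetry of `Γ` and `V W a = W V a` the Christoffel terms of the two identities coincide,
  -- so they cancel in the difference and `hd` remains.
  have c1 := hVc.fderiv_coordMatrix hφ hU hV (coordMatrix φ W u a) a hu'
  have c2 := hWc.fderiv_coordMatrix hφ hU hW (coordMatrix φ V u a) a hu'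
  rw [gamma_symm hφ hD hu, ha] at c1
  rw [← eq_sub_iff_add_eq] at c1 c2
  unfold mixedDeriv
  rw [map_add, map_add, hb, c1, c2]
  linear_combination (norm := module) hd

end Potentials

/-! ### Diagonal products in canonical coordinates -/

section CanonicalCharts

/-- The standard basis of `ℝⁿ`. -/
abbrev stdVec {n : ℕ} (i : Fin n) : Coords n := EuclideanSpace.single i (1 : ℝ)

variable {n : ℕ} {M : Type*} [TopologicalSpace M] [ChartedSpace (EuclideanSpace ℝ (Fin n)) M]
  [IsManifold (𝓡 n) ∞ M]

theorem bracket_congr {U : Set M} (hU : IsOpen U) {X X' Y Y' : VField n M}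
    (hX : ∀ x ∈ U, X x = X' x) (hY : ∀ x ∈ U, Y x = Y' x) {x : M} (hx : x ∈ U) :
    bracket X Y x = bracket X' Y' x :=
  Filter.EventuallyEq.mlieBracket_vectorField_eq (Filter.eventually_of_mem (hU.mem_nhds hx) hX)
    (Filter.eventually_of_mem (hU.mem_nhds hx) hY)

/-- The product `c` with unit `F` is diagonal in the chart `φ`: its product of the coordinate
fields `∂_j`, `∂_k` is `δ_{jk} (F^j)⁻¹ ∂_j`. -/
structure DiagonalIn (c : MulField n M) (F : VField n M)
    (φ : OpenPartialHomeomorph M (Coords n)) : Prop where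
  ne_zero : ∀ u ∈ φ.target, ∀ i, localRep φ F u i ≠ 0
  mul : ∀ (X Y : VField n M), ∀ u ∈ φ.target, ∀ i, localRep φ (mulVF c X Y) u i * localRep φ F u i =
    localRep φ X u i * localRep φ Y u i

theorem localRep_mulVF {c : MulField n M} {φ : OpenPartialHomeomorph M (Coords n)}
    (hφ : IsCanonicalChart c φ) (X Y : VField n M) {u : Coords n} (hu : u ∈ φ.target) (i : Fin n) :
    localRep φ (mulVF c X Y) u i = localRep φ X u i * localRep φ Y u i := by
  have hx := φ.map_target hu
  have hsum : ∀ Z : VField n M, Z (φ.symm u) =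
      ∑ k, localRep φ Z u k • coordField φ k (φ.symm u) := fun Z ↦ by
    have := vfield_eq_sum hφ.1 Z hx
    rwa [φ.right_inv hu] at this
  have h1 : mulVF c X Y (φ.symm u) =
      ∑ k, (localRep φ X u k * localRep φ Y u k) • coordField φ k (φ.symm u) := by
    unfold mulVF
    rw [hsum X, hsum Y, map_sum]
    refine Finset.sum_congr rfl fun k _ ↦ ?_
    rw [map_sum (c (φ.symm u)), sum_apply, Finset.sum_eq_single k]
    · rw [map_smul, map_smul, smul_apply, hφ.2 _ hx, if_pos rfl, smul_smul, mul_comm]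
    · intro l _ hl
      rw [map_smul, map_smul, smul_apply, hφ.2 _ hx, if_neg hl, smul_zero, smul_zero]
    · simp
  have h2 : localRep φ (mulVF c X Y) u =
      ∑ k, (localRep φ X u k * localRep φ Y u k) • stdVec k := by
    refine (congrArg (mfderiv (𝓡 n) (𝓡 n) φ (φ.symm u)) h1).trans ?_
    rw [map_sum]
    simp only [map_smul]
    refine Finset.sum_congr rfl fun k _ ↦ ?_
    rw [mfderiv_chart_coordField hφ.1 k hx]
    rfl
  rw [h2]
  simp [Pi.single_apply]

theorem localRep_unit {c : MulField n M} {e : VField n M} (hc : IsFManifold c e)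
    {φ : OpenPartialHomeomorph M (Coords n)} (hφ : IsCanonicalChart c φ) {u : Coords n}
    (hu : u ∈ φ.target) (i : Fin n) : localRep φ e u i = 1 := by
  have h : mulVF c (coordField φ i) e = coordField φ i := funext fun x ↦ hc.mul_unit x _
  have h' := localRep_mulVF hφ (coordField φ i) e hu i
  rw [h, localRep_coordField hφ.1 i hu] at h'
  simpa using h'.symm

theorem diagonalIn_canonical {c : MulField n M} {e : VField n M} (hc : IsFManifold c e)
    {φ : OpenPartialHomeomorph M (Coords n)} (hφ : IsCanonicalChart c φ) : DiagonalIn c e φ where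
  ne_zero u hu i := by rw [localRep_unit hc hφ hu]; exact one_ne_zero
  mul X Y u hu i := by rw [localRep_unit hc hφ hu, mul_one, localRep_mulVF hφ X Y hu]

/-- From `E ∘ E⁻¹ = e` the components of `E⁻¹` are the reciprocals of those of `E`. Both products
thus fall under `DiagonalIn`, with `F = e` and `F = E`, and the later lemmas apply to either. -/
theorem diagonalIn_dualMul {c : MulField n M} {e E Einv : VField n M} (hc : IsFManifold c e)
    (hE : IsEventualIdentity c e E Einv) {φ : OpenPartialHomeomorph M (Coords n)}
    (hφ : IsCanonicalChart c φ) : DiagonalIn (dualMul c Einv) E φ := by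
  have h1 : ∀ u ∈ φ.target, ∀ i, localRep φ E u i * localRep φ Einv u i = 1 := by
    intro u hu i
    rw [← localRep_mulVF hφ E Einv hu, ← localRep_unit hc hφ hu i]
    exact congrArg (fun Z ↦ localRep φ Z u i) (funext hE.mul_inv)
  refine ⟨fun u hu i h ↦ ?_, fun X Y u hu i ↦ ?_⟩
  · have := h1 u hu i
    rw [h, zero_mul] at this
    exact zero_ne_one this
  · have h2 : mulVF (dualMul c Einv) X Y = mulVF c (mulVF c X Y) Einv := rfl
    rw [h2, localRep_mulVF hφ _ _ hu, localRep_mulVF hφ _ _ hu, mul_assoc,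
      mul_comm (localRep φ Einv u i), h1 u hu, mul_one]

theorem vfield_ext {φ : OpenPartialHomeomorph M (Coords n)}
    (hφ : φ ∈ IsManifold.maximalAtlas (𝓡 n) ∞ M) {X Y : VField n M} {x : M} (hx : x ∈ φ.source)
    (h : ∀ i, localRep φ X (φ x) i = localRep φ Y (φ x) i) : X x = Y x := by
  rw [vfield_eq_sum hφ X hx, vfield_eq_sum hφ Y hx]
  simp only [h]

/-- The `i`-th idempotent `F^i ∂_i` of a diagonal product with unit `F`. -/
def idemField (φ : OpenPartialHomeomorph M (Coords n)) (F : VField n M) (i : Fin n) : VField n M :=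
  ofLocal φ fun u ↦ localRep φ F u i • stdVec i

section

variable {c : MulField n M} {F : VField n M} {φ : OpenPartialHomeomorph M (Coords n)}
  (hφ : φ ∈ IsManifold.maximalAtlas (𝓡 n) ∞ M)

include hφ

theorem contDiffOn_localRep_of_smooth (hF : SmoothVF Set.univ F) :
    ContDiffOn ℝ ∞ (localRep φ F) φ.target :=
  (hF.contDiffOn hφ).mono fun _ hu ↦ ⟨hu, trivial⟩

theorem localRep_idemField (i k : Fin n) {u : Coords n} (hu : u ∈ φ.target) :
    localRep φ (idemField φ F i) u k = if k = i then localRep φ F u i else 0 := by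
  unfold idemField
  rw [localRep_ofLocal hφ _ hu]
  simp

theorem differentiableAt_localRep (hF : SmoothVF Set.univ F) {u : Coords n} (hu : u ∈ φ.target) :
    DifferentiableAt ℝ (localRep φ F) u :=
  ((contDiffOn_localRep_of_smooth hφ hF).contDiffAt (φ.open_target.mem_nhds hu)).differentiableAt
    (by simp)

theorem smoothVF_idemField (hF : SmoothVF Set.univ F) (i : Fin n) :
    SmoothVF φ.source (idemField φ F i) := by
  have h : ContDiffOn ℝ ∞ (fun u ↦ localRep φ F u i • stdVec i) (coordDomain φ Set.univ) :=
    ((EuclideanSpace.proj (𝕜 := ℝ) i).contDiff.comp_contDiffOn (hF.contDiffOn hφ)).smul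
      contDiffOn_const
  exact (smoothVF_ofLocal hφ h).mono fun _ hx ↦ ⟨hx, trivial⟩

theorem fderiv_localRep_idemField (hF : SmoothVF Set.univ F) (i : Fin n) {u : Coords n}
    (hu : u ∈ φ.target) (b : Coords n) :
    fderiv ℝ (localRep φ (idemField φ F i)) u b = (fderiv ℝ (localRep φ F) u b i) • stdVec i := by
  have h1 : localRep φ (idemField φ F i) =ᶠ[𝓝 u] fun u ↦ localRep φ F u i • stdVec i :=
    Filter.eventually_of_mem (φ.open_target.mem_nhds hu) fun v hv ↦ localRep_ofLocal hφ _ hv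
  have h2 : HasFDerivAt (fun u ↦ localRep φ F u i)
      ((EuclideanSpace.proj (𝕜 := ℝ) i).comp (fderiv ℝ (localRep φ F) u)) u :=
    (EuclideanSpace.proj (𝕜 := ℝ) i).hasFDerivAt.comp u (differentiableAt_localRep hφ hF hu).hasFDerivAt
  rw [h1.fderiv_eq, (h2.smul_const _).fderiv]
  rfl

variable (hd : DiagonalIn c F φ)

include hd

theorem DiagonalIn.eq_of_mul_eq {X Y Z : VField n M} {x : M} (hx : x ∈ φ.source)
    (h : ∀ i, localRep φ X (φ x) i * localRep φ Y (φ x) i =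
      localRep φ Z (φ x) i * localRep φ F (φ x) i) : mulVF c X Y x = Z x := by
  have hu := φ.map_source hx
  refine vfield_ext hφ hx fun i ↦ ?_
  have h1 := hd.mul X Y _ hu i
  rw [h] at h1
  exact mul_right_cancel₀ (hd.ne_zero _ hu i) h1

theorem DiagonalIn.mul_idemField_coordField (i j : Fin n) {x : M} (hx : x ∈ φ.source) :
    mulVF c (idemField φ F i) (coordField φ j) x = if i = j then coordField φ j x else 0 := by
  have hu := φ.map_source hx
  split_ifs with hij
  · subst hij
    refine hd.eq_of_mul_eq hφ hx fun k ↦ ?_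
    rw [localRep_idemField hφ _ _ hu, localRep_coordField hφ _ hu]
    by_cases hk : k = i <;> simp [hk]
  · refine hd.eq_of_mul_eq (Z := 0) hφ hx fun k ↦ ?_
    rw [localRep_idemField hφ _ _ hu, localRep_coordField hφ _ hu, localRep_eq_zero hφ (X := 0) rfl]
    by_cases hk : k = i <;> simp [hk, hij]

theorem DiagonalIn.mul_idemField_idemField (i j : Fin n) {x : M} (hx : x ∈ φ.source) :
    mulVF c (idemField φ F i) (idemField φ F j) x = if i = j then idemField φ F j x else 0 := by
  have hu := φ.map_source hx
  split_ifs with hij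
  · subst hij
    refine hd.eq_of_mul_eq hφ hx fun k ↦ ?_
    rw [localRep_idemField hφ _ _ hu]
    by_cases hk : k = i <;> simp [hk]
  · refine hd.eq_of_mul_eq (Z := 0) hφ hx fun k ↦ ?_
    rw [localRep_idemField hφ _ _ hu, localRep_idemField hφ _ _ hu, localRep_eq_zero hφ (X := 0) rfl]
    by_cases hk : k = i <;> simp [hk, hij]

/-- The Hertling–Manin condition makes the idempotents commute, so that the `j`-th component of the
unit depends on the `j`-th coordinate only. -/
theorem DiagonalIn.fderiv_unit (hF : IsFManifold c F) {i j : Fin n} (hij : i ≠ j) {u : Coords n}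
    (hu : u ∈ φ.target) : fderiv ℝ (localRep φ F) u (stdVec i) j = 0 := by
  have hx := φ.map_target hu
  have hs := fun k ↦ smoothVF_idemField hφ hF.smooth_unit k
  -- With both pairs of arguments equal to the idempotents `π_i` and `π_j`, the condition reads `B -
  -- 2 B∘π_j - 2 π_i∘B + 4 π_i∘B∘π_j = 0` for `B = [π_i, π_j]`. Its `j`-th component is `-B^j = 0`,
  -- and `B^j = F^i ∂_i F^j` with `F^i ≠ 0`.
  have hm := hF.hertling_manin φ.source φ.open_source _ _ _ _ (hs i) (hs i) (hs j) (hs j) _ hx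
  set X := idemField φ F i with hX
  set Z := idemField φ F j with hZ
  have hXX : ∀ x ∈ φ.source, mulVF c X X x = X x := fun x hx ↦ by
    simpa using hd.mul_idemField_idemField hφ i i hx
  have hZZ : ∀ x ∈ φ.source, mulVF c Z Z x = Z x := fun x hx ↦ by
    simpa using hd.mul_idemField_idemField hφ j j hx
  have b1 : bracket (mulVF c X X) (mulVF c Z Z) (φ.symm u) = bracket X Z (φ.symm u) :=
    bracket_congr φ.open_source hXX hZZ hx
  have b2 : bracket (mulVF c X X) Z (φ.symm u) = bracket X Z (φ.symm u) :=
    bracket_congr φ.open_source hXX (fun _ _ ↦ rfl) hx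
  have b3 : bracket X (mulVF c Z Z) (φ.symm u) = bracket X Z (φ.symm u) :=
    bracket_congr φ.open_source (fun _ _ ↦ rfl) hZZ hx
  set B := bracket X Z with hB
  have hm' : (B - mulVF c B Z - mulVF c B Z - mulVF c X B + mulVF c (mulVF c X B) Z +
      mulVF c (mulVF c X B) Z - mulVF c X B + mulVF c (mulVF c X B) Z +
      mulVF c (mulVF c X B) Z) (φ.symm u) = 0 := by
    simp only [Pi.add_apply, Pi.sub_apply, mulVF] at hm b1 b2 b3 ⊢
    rw [b1, b2, b3] at hm
    exact hm
  have key := localRep_eq_zero hφ hm'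
  have hcomp := congrArg (fun w : Coords n ↦ w j) key
  have hadd : ∀ Y Y' : VField n M, localRep φ (Y + Y') u = localRep φ Y u + localRep φ Y' u :=
    fun Y Y' ↦ map_add (mfderiv (𝓡 n) (𝓡 n) φ (φ.symm u)) _ _
  simp only [hadd, localRep_sub hφ, PiLp.add_apply, PiLp.sub_apply, PiLp.zero_apply] at hcomp
  have hne := hd.ne_zero u hu j
  have m1 : localRep φ (mulVF c B Z) u j = localRep φ B u j := by
    have := hd.mul B Z u hu j
    rw [hZ, localRep_idemField hφ _ _ hu, if_pos rfl] at this
    exact mul_right_cancel₀ hne this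
  have m2 : ∀ Y, localRep φ (mulVF c X Y) u j = 0 := by
    intro Y
    have := hd.mul X Y u hu j
    rw [hX, localRep_idemField hφ _ _ hu, if_neg hij.symm, zero_mul] at this
    exact (mul_eq_zero.1 this).resolve_right hne
  have m3 : localRep φ (mulVF c (mulVF c X B) Z) u j = 0 := by
    have := hd.mul (mulVF c X B) Z u hu j
    rw [m2, zero_mul] at this
    exact (mul_eq_zero.1 this).resolve_right hne
  rw [m1, m2, m3] at hcomp
  have hBj : localRep φ B u j = 0 := by linarith
  rw [hB, localRep_bracket hφ φ.open_source (hs i) (hs j) ⟨hu, hx⟩,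
    fderiv_localRep_idemField hφ hF.smooth_unit _ hu,
    fderiv_localRep_idemField hφ hF.smooth_unit _ hu] at hBj
  have hXu : localRep φ X u = localRep φ F u i • stdVec i := localRep_ofLocal hφ _ hu
  rw [hXu, map_smul] at hBj
  have : localRep φ F u i * fderiv ℝ (localRep φ F) u (stdVec i) j = 0 := by
    simpa [Pi.single_apply, hij.symm] using hBj
  exact (mul_eq_zero.1 this).resolve_left (hd.ne_zero u hu i)

end

end CanonicalCharts

/-! ### Christoffel symbols of compatible and of equivalent connections -/

section Compatibility

variable {n : ℕ} {M : Type*} [TopologicalSpace M] [ChartedSpace (EuclideanSpace ℝ (Fin n)) M]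
  [IsManifold (𝓡 n) ∞ M] {c : MulField n M} {F : VField n M}
  {φ : OpenPartialHomeomorph M (Coords n)} (hφ : φ ∈ IsManifold.maximalAtlas (𝓡 n) ∞ M)
  {D D' : Conn n M} (hd : DiagonalIn c F φ) (hF : IsFManifold c F)

include hφ hd hF

/-- If `d_∇` and `d_∇'` agree on all `X ∘`, then the Christoffel symbols `Γ^l_{jk}`, `j ≠ k`, of the
two connections agree. -/
theorem SameExtDOnMul.gamma_eq (h : SameExtDOnMul c D D') {j k : Fin n} (hjk : j ≠ k)
    {u : Coords n} (hu : u ∈ φ.target) :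
    gamma D φ u (stdVec k) (stdVec j) = gamma D' φ u (stdVec k) (stdVec j) := by
  have hx := φ.map_target hu
  -- Multiplication by the idempotent `π_k` fixes `∂_k` and kills `∂_j`. Hence `d_∇(π_k ∘)(∂_j,
  -- ∂_k)` is `∇_{∂_j} ∂_k` up to terms that do not involve the connection.
  have hP := smoothVF_idemField hφ hF.smooth_unit k
  have h1 := h φ.source φ.open_source _ hP _ _ (smoothVF_coordField hφ j)
    (smoothVF_coordField hφ k) _ hx
  have hV := smoothEnd_mulEnd hF hP
  have h2 := localRep_eq_zero hφ (X := extD₁ D _ _ _ - extD₁ D' _ _ _) h1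
  rw [localRep_sub hφ, coordField_eq_ofLocal, coordField_eq_ofLocal,
    localRep_extD₁ hφ D φ.open_source hV _ _ ⟨hu, hx⟩,
    localRep_extD₁ hφ D' φ.open_source hV _ _ ⟨hu, hx⟩] at h2
  have happ : ∀ i, coordMatrix φ (mulEnd c (idemField φ F k)) u (stdVec i) =
      if k = i then stdVec i else 0 := by
    intro i
    have h3 : localRep φ (coordField φ i) u = stdVec i := localRep_coordField hφ i hu
    rw [← h3, coordMatrix_localRep hφ _ _ hu]
    have h4 := hd.mul_idemField_coordField hφ k i hx
    split_ifs at h4 ⊢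
    · exact congrArg (mfderiv (𝓡 n) (𝓡 n) φ (φ.symm u)) h4
    · exact localRep_eq_zero hφ h4
  rw [happ, happ, if_pos rfl, if_neg hjk.symm] at h2
  simp only [map_zero, zero_apply, add_zero, sub_sub_sub_cancel_right,
    add_sub_add_left_eq_sub] at h2
  exact sub_eq_zero.1 h2

/-- Symmetry of `∇∘` on `∂_i, ∂_j` and the idempotent `ζ = F^j ∂_j` gives, after torsion-freeness,
`∇_{∂_i} ∂_j = ∂_j ∘ ∇_{∂_i} ζ - ∂_i ∘ ∇_{∂_j} ζ`. The right side has only `i`-th and `j`-th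
components, and its `i`-th one is `-(F^j / F^i) Γ^i_{jj}`. -/
theorem IsCompatible.localRep_gamma (hD : IsCompatible c D) {i j : Fin n} (hij : i ≠ j)
    {u : Coords n} (hu : u ∈ φ.target) (l : Fin n) :
    (l ≠ i → l ≠ j → gamma D φ u (stdVec i) (stdVec j) l = 0) ∧
    localRep φ F u i * gamma D φ u (stdVec i) (stdVec j) i +
      localRep φ F u j * gamma D φ u (stdVec j) (stdVec j) i = 0 := by
  have hx := φ.map_target hu
  have hP := smoothVF_idemField hφ hF.smooth_unit j
  set ζ := idemField φ F j with hζ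
  have h1 := hD.symm_mul φ.source φ.open_source _ _ _ (smoothVF_coordField hφ i)
    (smoothVF_coordField hφ j) hP _ hx
  have hcomm : ∀ X Y : VField n M, mulVF c X Y = mulVF c Y X := fun X Y ↦
    funext fun x ↦ hF.comm x _ _
  have e1 : covD D (coordField φ i) (mulVF c (coordField φ j) ζ) (φ.symm u) =
      covD D (coordField φ i) (coordField φ j) (φ.symm u) :=
    congrArg (fun L ↦ L (coordField φ i (φ.symm u))) (conn_congr D φ.open_source
      (smoothVF_coordField hφ j) (fun y hy ↦ by
        rw [hcomm, hζ, hd.mul_idemField_coordField hφ j j hy, if_pos rfl]) hx).symm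
  have e2 : covD D (coordField φ j) (mulVF c (coordField φ i) ζ) (φ.symm u) = 0 := by
    have h0 : D (mulVF c (coordField φ i) ζ) (φ.symm u) = D (0 : VField n M) (φ.symm u) :=
      conn_congr D φ.open_source (smoothVF_mulVF hF (smoothVF_coordField hφ i) hP) (fun y hy ↦ by
        rw [hcomm, hζ, hd.mul_idemField_coordField hφ j i hy, if_neg hij.symm]; rfl) hx
    rw [D.zero] at h0
    exact congrArg (fun L ↦ L (coordField φ j (φ.symm u))) h0
  have h2 : (covD D (coordField φ i) (coordField φ j) -
      mulVF c (covD D (coordField φ i) (coordField φ j)) ζ -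
      mulVF c (coordField φ j) (covD D (coordField φ i) ζ) -
      (0 - mulVF c (covD D (coordField φ j) (coordField φ i)) ζ -
      mulVF c (coordField φ i) (covD D (coordField φ j) ζ))) (φ.symm u) = 0 := by
    have h3 := sub_eq_zero.2 h1
    simp only [covDMul, Pi.sub_apply, Pi.zero_apply] at h3 e1 e2 ⊢
    rw [e1, e2] at h3
    exact h3
  -- Each component is multiplied by `F^k` so that the diagonal product can be evaluated without
  -- division.
  have h4 := congrArg (fun w : Coords n ↦ fun k ↦ w k * localRep φ F u k) (localRep_eq_zero hφ h2)
  have hz : localRep φ (0 : VField n M) u = 0 := localRep_eq_zero hφ rfl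
  simp only [localRep_sub hφ, PiLp.sub_apply, PiLp.zero_apply, zero_mul, sub_mul, hd.mul _ _ u hu,
    hz] at h4
  have hji : localRep φ (covD D (coordField φ j) (coordField φ i)) u =
      gamma D φ u (stdVec i) (stdVec j) := localRep_covD_ofLocal_const hφ D _ _ hu
  have hij' : localRep φ (covD D (coordField φ i) (coordField φ j)) u =
      gamma D φ u (stdVec i) (stdVec j) :=
    (localRep_covD_ofLocal_const hφ D _ _ hu).trans (gamma_symm hφ hD.torsionless hu _ _)
  have hζu : localRep φ ζ u = localRep φ F u j • stdVec j := localRep_ofLocal hφ _ hu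
  have hjζ : localRep φ (covD D (coordField φ j) ζ) u =
      fderiv ℝ (localRep φ F) u (stdVec j) j • stdVec j +
        localRep φ F u j • gamma D φ u (stdVec j) (stdVec j) := by
    rw [localRep_covD D hφ φ.open_source hP _ ⟨hu, hx⟩, localRep_coordField hφ _ hu,
      fderiv_localRep_idemField hφ hF.smooth_unit _ hu, hζu, map_smul]
    rfl
  rw [hji, hij', hjζ, localRep_coordField hφ _ hu, localRep_coordField hφ _ hu] at h4
  constructor
  · intro hli hlj
    have h5 := congrFun h4 l
    simp [hli, hlj] at h5
    exact h5.resolve_right (hd.ne_zero u hu l)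
  · have h5 := congrFun h4 i
    simp [hij] at h5
    linarith

end Compatibility

/-! ### Diagonal tensor fields as multiplications -/

section Multiplications

variable {n : ℕ} {M : Type*} [TopologicalSpace M] [ChartedSpace (EuclideanSpace ℝ (Fin n)) M]
  [IsManifold (𝓡 n) ∞ M] {c : MulField n M} {e E : VField n M}

/-- On `U`, the `(1,1)`-tensor field `V` is the multiplication by the vector field `V e`. -/
def IsMulOn (c : MulField n M) (e : VField n M) (U : Set M) (V : EndField n M) : Prop :=
  ∀ x ∈ U, V x = mulEnd c (V.app e) x

theorem mulEnd_comp_comm (hc : IsFManifold c e) (X Y : VField n M) (x : M) :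
    mulEnd c X x ∘L mulEnd c Y x = mulEnd c Y x ∘L mulEnd c X x := by
  ext1 v
  change c x (X x) (c x (Y x) v) = c x (Y x) (c x (X x) v)
  rw [← hc.assoc, ← hc.assoc, hc.comm x (X x)]

theorem IsMulOn.commuteOn (hc : IsFManifold c e) {U : Set M} {V W : EndField n M}
    (hV : IsMulOn c e U V) (hW : IsMulOn c e U W) : CommuteOn U V W := fun x hx ↦ by
  rw [hV x hx, hW x hx, mulEnd_comp_comm hc]

theorem isMulOn_mulEnd (hc : IsFManifold c e) (U : Set M) (X : VField n M) :
    IsMulOn c e U (mulEnd c X) := fun x _ ↦ by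
  unfold mulEnd EndField.app
  rw [hc.mul_unit]

theorem IsMulOn.congr {U : Set M} {V W : EndField n M} (hV : IsMulOn c e U V)
    (h : ∀ x ∈ U, W x = V x) : IsMulOn c e U W := fun x hx ↦ by
  rw [h x hx, hV x hx]
  unfold mulEnd EndField.app
  rw [h x hx]

section

variable {φ : OpenPartialHomeomorph M (Coords n)} (hφ : IsCanonicalChart c φ)

include hφ

/-- A diagonal matrix multiplies componentwise by its diagonal, which is its value on `e = (1, …,
1)`. -/
theorem eq_mulEnd_of_offdiag (hc : IsFManifold c e) {V : EndField n M} {x : M}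
    (hx : x ∈ φ.source)
    (h : ∀ i j, i ≠ j → coordMatrix φ V (φ x) (stdVec j) i = 0) :
    V x = mulEnd c (V.app e) x := by
  have hu := φ.map_source hx
  have hcol : ∀ a : Coords n, ∀ i, coordMatrix φ V (φ x) a i =
      a i * coordMatrix φ V (φ x) (stdVec i) i := by
    intro a i
    conv_lhs => rw [coords_eq_sum a]
    rw [map_sum]
    simp only [map_smul, WithLp.ofLp_sum, Finset.sum_apply, PiLp.smul_apply, smul_eq_mul]
    refine Finset.sum_eq_single i (fun j _ hj ↦ ?_) (by simp)
    rw [h i j hj.symm, mul_zero]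
  apply coordMatrix_injective hφ.1 hx
  ext b i
  rw [coordMatrix_apply hφ.1 (mulEnd c (V.app e)) b hu]
  change _ = localRep φ (mulVF c (V.app e) (ofLocal φ fun _ ↦ b)) (φ x) i
  rw [localRep_mulVF hφ _ _ hu, localRep_ofLocal hφ.1 _ hu, ← coordMatrix_localRep hφ.1 _ _ hu,
    hcol, hcol (localRep φ e (φ x)), localRep_unit hc hφ hu, one_mul, mul_comm]

theorem offdiag_of_isMulOn {U : Set M} {V : EndField n M} (hV : IsMulOn c e U V) {u : Coords n}
    (hu : u ∈ coordDomain φ U) (j : Fin n) :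
    coordMatrix φ V u (stdVec j) = coordMatrix φ V u (stdVec j) j • stdVec j := by
  have h1 : coordMatrix φ V u (stdVec j) =
      localRep φ (mulVF c (V.app e) (ofLocal φ fun _ ↦ stdVec j)) u := by
    rw [coordMatrix_apply hφ.1 _ _ hu.1]
    exact congrArg (fun L ↦ mfderiv (𝓡 n) (𝓡 n) φ (φ.symm u)
      (L ((ofLocal φ fun _ ↦ stdVec j) (φ.symm u)))) (hV _ hu.2)
  ext i
  rw [h1, PiLp.smul_apply, localRep_mulVF hφ _ _ hu.1, localRep_mulVF hφ _ _ hu.1,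
    localRep_ofLocal hφ.1 _ hu.1]
  by_cases hij : i = j <;> simp [hij]

/-- If `E^i = E^j` on a neighbourhood, their differentials coincide there. But that open set
contains a point where the differentials are independent, hence pairwise distinct. -/
theorem frequently_component_ne (hind : HasIndependentComponents c E) {i j : Fin n} (hij : i ≠ j)
    {u : Coords n} (hu : u ∈ φ.target) : ∃ᶠ v in 𝓝 u, localRep φ E v i ≠ localRep φ E v j := by
  intro h
  simp only [ne_eq, not_not] at h
  obtain ⟨O, hO, hOo, huO⟩ := eventually_nhds_iff.1 h
  have hopen : IsOpen (φ.source ∩ φ ⁻¹' O) := φ.isOpen_inter_preimage hOo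
  obtain ⟨y, hy, hyS, hli⟩ := mem_closure_iff.1 (hind φ hφ (φ.map_target hu)) _ hopen
    ⟨φ.map_target hu, by simpa [φ.right_inv hu] using huO⟩
  refine hij (hli.injective ?_)
  refine differential_congr hφ.1 (Filter.eventually_of_mem (hopen.mem_nhds hy) fun z hz ↦ ?_)
  change coordComp φ i z (E z) = coordComp φ j z (E z)
  rw [coordComp_eq hφ.1 E i hz.1, coordComp_eq hφ.1 E j hz.1]
  exact hO _ hz.2

/-- A smooth `(1,1)`-tensor field that commutes with `E ∘` is diagonal in canonical coordinates. -/
theorem offdiag_of_commuteOn (hind : HasIndependentComponents c E) {U : Set M} (hU : IsOpen U)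
    {V : EndField n M} (hV : SmoothEnd U V) (hcomm : CommuteOn U V (mulEnd c E)) {u : Coords n}
    (hu : u ∈ coordDomain φ U) {i j : Fin n} (hij : i ≠ j) :
    coordMatrix φ V u (stdVec j) i = 0 := by
  by_contra hne
  have hnh := (isOpen_coordDomain φ hU).mem_nhds hu
  have hcont : ContinuousAt (fun v ↦ coordMatrix φ V v (stdVec j) i) u := by
    have h1 := ((hV.contDiffOn hφ.1 hU).contDiffAt hnh).continuousAt
    exact (EuclideanSpace.proj (𝕜 := ℝ) i).continuous.continuousAt.comp
      (h1.clm_apply continuousAt_const)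
  -- By continuity a nonzero entry stays nonzero near `u`, so it is nonzero at some `v` with `E^i ≠
  -- E^j`. There the commutator says `(E^j - E^i) V^i_j = 0`.
  obtain ⟨v, hv, hvne, hvU⟩ := ((frequently_component_ne hφ hind hij hu.1).and_eventually
    ((hcont.eventually_ne hne).and hnh)).exists
  have h1 : V.app (mulVF c E (ofLocal φ fun _ ↦ stdVec j)) (φ.symm v) =
      mulVF c E (V.app (ofLocal φ fun _ ↦ stdVec j)) (φ.symm v) :=
    congrArg (fun L ↦ L ((ofLocal φ fun _ ↦ stdVec j) (φ.symm v))) (hcomm _ hvU.2)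
  have h2 : localRep φ (V.app (mulVF c E (ofLocal φ fun _ ↦ stdVec j))) v =
      localRep φ (mulVF c E (V.app (ofLocal φ fun _ ↦ stdVec j))) v :=
    congrArg (mfderiv (𝓡 n) (𝓡 n) φ (φ.symm v)) h1
  have h3 : localRep φ (mulVF c E (ofLocal φ fun _ ↦ stdVec j)) v = localRep φ E v j • stdVec j := by
    ext k
    rw [localRep_mulVF hφ _ _ hvU.1, localRep_ofLocal hφ.1 _ hvU.1]
    by_cases hk : k = j <;> simp [hk]
  have h4 := congrArg (fun w : Coords n ↦ w i) h2
  simp only [localRep_mulVF hφ _ _ hvU.1] at h4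
  rw [← coordMatrix_localRep hφ.1 _ _ hvU.1, h3, map_smul, PiLp.smul_apply, smul_eq_mul,
    ← coordMatrix_apply hφ.1 _ _ hvU.1] at h4
  exact hv (mul_right_cancel₀ hvne h4).symm

end

theorem gamma_expand (D : Conn n M) (φ : OpenPartialHomeomorph M (Coords n)) (u a b : Coords n)
    (i : Fin n) : gamma D φ u a b i = ∑ k, a k * gamma D φ u (stdVec k) b i := by
  conv_lhs => rw [coords_eq_sum a]
  simp [map_sum, sum_apply]

/-- Since `Γ^i_{kj} = 0` for distinct indices, only `k = i` and `k = j` contribute to an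
off-diagonal entry of a covariant derivative. -/
theorem IsCompatible.gamma_component {c : MulField n M} {F : VField n M} {D : Conn n M}
    {φ : OpenPartialHomeomorph M (Coords n)} (hφ : φ ∈ IsManifold.maximalAtlas (𝓡 n) ∞ M)
    (hd : DiagonalIn c F φ) (hF : IsFManifold c F) (hD : IsCompatible c D) {i j : Fin n}
    (hij : i ≠ j) {u : Coords n} (hu : u ∈ φ.target) (a : Coords n) :
    gamma D φ u a (stdVec j) i = a i * gamma D φ u (stdVec i) (stdVec j) i +
      a j * gamma D φ u (stdVec j) (stdVec j) i := by
  rw [gamma_expand]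
  refine Fintype.sum_eq_add i j hij fun k hk ↦ ?_
  rw [(hD.localRep_gamma hφ hd hF hk.2 hu i).1 hk.1.symm hij, mul_zero]

end Multiplications

/-! ### The twisted recursion and its hierarchy -/

section TwistedLenardMagri

variable {n : ℕ} {M : Type*} [TopologicalSpace M] [T2Space M]
  [ChartedSpace (EuclideanSpace ℝ (Fin n)) M]
  [IsManifold (𝓡 n) ∞ M] {c : MulField n M} {e E Einv : VField n M} {D D₁ D₂ : Conn n M}

/-- If `d_{∇¹} X` commutes with `E ∘`, then `d_{∇²} (E ∘ X)` is a multiplication. -/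
theorem isMulOn_extD₀_mulVF (hF : IsFManifold c e) (hss : IsSemisimple c)
    (hE : IsEventualIdentity c e E Einv) (hind : HasIndependentComponents c E)
    (hD₁ : IsCompatible c D₁) (hD₂ : IsCompatible (dualMul c Einv) D₂)
    (heq : AlmostHydroEquiv c (dualMul c Einv) D₁ D₂) {U : Set M} (hU : IsOpen U) {X : VField n M}
    (hX : SmoothVF U X) (hcomm : CommuteOn U (extD₀ D₁ X) (mulEnd c E)) :
    IsMulOn c e U (extD₀ D₂ (mulVF c E X)) := by
  intro x hx
  obtain ⟨φ, hφ, hxφ⟩ := hss x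
  have hu := mem_coordDomain hxφ hx
  have hd₁ := diagonalIn_canonical hF hφ
  have hd₂ := diagonalIn_dualMul hF hE hφ
  refine eq_mulEnd_of_offdiag hφ hF hxφ fun i j hij ↦ ?_
  have h1 := offdiag_of_commuteOn hφ hind hU (smoothEnd_extD₀ hD₁.smooth hX) hcomm hu hij
  have hEX : SmoothVF U (mulVF c E X) := smoothVF_mulVF hF (hE.smooth.mono (Set.subset_univ U)) hX
  rw [coordMatrix_extD₀ D₁ hφ.1 hU hX hu, PiLp.add_apply,
    hD₁.gamma_component hφ.1 hd₁ hF hij hu.1] at h1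
  rw [coordMatrix_extD₀ D₂ hφ.1 hU hEX hu, PiLp.add_apply,
    hD₂.gamma_component hφ.1 hd₂ hE.dual hij hu.1, localRep_mulVF hφ _ _ hu.1,
    localRep_mulVF hφ _ _ hu.1]
  set u := φ x
  have hg : gamma D₁ φ u (stdVec i) (stdVec j) = gamma D₂ φ u (stdVec i) (stdVec j) := by
    rcases heq with h | h
    · exact h.gamma_eq hφ.1 hd₁ hF hij.symm hu.1
    · exact h.gamma_eq hφ.1 hd₂ hE.dual hij.symm hu.1
  have h2 := (hD₁.localRep_gamma hφ.1 hd₁ hF hij hu.1 i).2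
  have h3 := (hD₂.localRep_gamma hφ.1 hd₂ hE.dual hij hu.1 i).2
  rw [localRep_unit hF hφ hu.1, localRep_unit hF hφ hu.1, one_mul, one_mul] at h2
  have hXd : DifferentiableAt ℝ (localRep φ X) u :=
    ((hX.contDiffOn hφ.1).contDiffAt ((isOpen_coordDomain φ hU).mem_nhds hu)).differentiableAt
      (by simp)
  have hEXd : DifferentiableAt ℝ (localRep φ (mulVF c E X)) u :=
    ((hEX.contDiffOn hφ.1).contDiffAt ((isOpen_coordDomain φ hU).mem_nhds hu)).differentiableAt
      (by simp)
  have hEd := differentiableAt_localRep hφ.1 hE.smooth hu.1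
  have hcompd : ∀ {Z : Coords n → Coords n}, DifferentiableAt ℝ Z u →
      HasFDerivAt (fun v ↦ Z v i) ((EuclideanSpace.proj (𝕜 := ℝ) i).comp (fderiv ℝ Z u)) u :=
    fun hZ ↦ (EuclideanSpace.proj (𝕜 := ℝ) i).hasFDerivAt.comp u hZ.hasFDerivAt
  -- `E^i` passes through `∂_j` because it depends on `u^i` only.
  have h4 : fderiv ℝ (localRep φ (mulVF c E X)) u (stdVec j) i =
      localRep φ E u i * fderiv ℝ (localRep φ X) u (stdVec j) i := by
    have h5 : (fun v ↦ localRep φ (mulVF c E X) v i) =ᶠ[𝓝 u]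
        fun v ↦ localRep φ E v i * localRep φ X v i :=
      Filter.eventually_of_mem (φ.open_target.mem_nhds hu.1)
        fun v hv ↦ localRep_mulVF hφ _ _ hv i
    have h6 := (hcompd hEXd).unique (((hcompd hEd).mul (hcompd hXd)).congr_of_eventuallyEq h5)
    have h7 := congrArg (fun L ↦ L (stdVec j)) h6
    have h8 : fderiv ℝ (localRep φ E) u (stdVec j) i = 0 :=
      hd₂.fderiv_unit hφ.1 hE.dual hij.symm hu.1
    simpa [h8] using h7
  rw [h4, ← hg]
  rw [← hg] at h3
  -- With `h2` and `h3` eliminating `Γ^i_{jj}` of both connections, the entry is `E^i` times that of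
  -- `d_{∇¹} X`, which vanishes by `h1`.
  linear_combination localRep φ E u i * h1 + localRep φ X u j * h3 -
    localRep φ E u i * localRep φ X u j * h2

theorem extD₁_congr (D : Conn n M) {U : Set M} (hU : IsOpen U) {V V' : EndField n M}
    (hV : SmoothEnd U V) (h : ∀ x ∈ U, V x = V' x) {X Y : VField n M} (hX : SmoothVF U X)
    (hY : SmoothVF U Y) {x : M} (hx : x ∈ U) : extD₁ D V X Y x = extD₁ D V' X Y x := by
  have h1 : ∀ X : VField n M, ∀ y ∈ U, V.app X y = V'.app X y := fun X y hy ↦ by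
    unfold EndField.app; rw [h y hy]
  have h2 : ∀ X : VField n M, SmoothVF U X → D (V.app X) x = D (V'.app X) x := fun X hX ↦
    conn_congr D hU (hV U hU le_rfl X hX) (h1 X) hx
  simp only [extD₁, covD, Pi.sub_apply]
  rw [h2 X hX, h2 Y hY, h1 _ x hx]

/-- `X ∘ = (E ∘ X) *`, so agreement on all `X *` gives agreement on all `X ∘`. -/
theorem AlmostHydroEquiv.sameExtD (hF : IsFManifold c e) (hE : IsEventualIdentity c e E Einv)
    (heq : AlmostHydroEquiv c (dualMul c Einv) D₁ D₂) : SameExtDOnMul c D₁ D₂ := by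
  rcases heq with h | h
  · exact h
  · intro U hU X hX Y Z hY hZ x hx
    have h1 : mulEnd c X = mulEnd (dualMul c Einv) (mulVF c E X) := by
      funext y
      ext1 v
      change c y (X y) v = c y (c y (c y (E y) (X y)) v) (Einv y)
      rw [hF.comm y (E y) (X y), hF.assoc y (X y), hF.assoc y (X y), hF.comm y (E y) v,
        hF.assoc y v, hE.mul_inv, hF.mul_unit]
    rw [h1]
    exact h U hU _ (smoothVF_mulVF hF (hE.smooth.mono (Set.subset_univ U)) hX) Y Z hY hZ x hx

/-- If `d_{∇²} Y` is a multiplication, then it is `d_{∇¹}`-closed. -/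
theorem isExtClosedOn_extD₀ (hF : IsFManifold c e) (h : SameExtDOnMul c D₁ D₂)
    (hD₂ : CovariantDerivative.ContMDiffCovariantDerivative D₂ ∞) (hflat : IsFlat D₂) {U : Set M}
    {Y : VField n M} (hY : SmoothVF U Y) (hmul : IsMulOn c e U (extD₀ D₂ Y)) :
    IsExtClosedOn D₁ (extD₀ D₂ Y) U := by
  intro W hW hWU A B hA hB x hx
  have hV : SmoothEnd W (extD₀ D₂ Y) := (smoothEnd_extD₀ hD₂ hY).mono hWU
  have hw : SmoothVF W ((extD₀ D₂ Y).app e) := hV W hW le_rfl e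
    (hF.smooth_unit.mono (Set.subset_univ W))
  have hVw : ∀ y ∈ W, extD₀ D₂ Y y = mulEnd c ((extD₀ D₂ Y).app e) y := fun y hy ↦
    hmul y (hWU hy)
  rw [extD₁_congr D₁ hW hV hVw hA hB hx]
  have h1 := h W hW _ hw A B hA hB x hx
  rw [Pi.sub_apply, sub_eq_zero, ← extD₁_congr D₂ hW hV hVw hA hB hx] at h1
  rw [h1]
  -- By definition `extD₁ D₂ (extD₀ D₂ Y) A B` is the curvature expression `R(A, B) Y`.
  exact hflat W hW A B Y hA hB (hY.mono hWU) x hx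

theorem christoffel_eq {φ : OpenPartialHomeomorph M (Coords n)}
    (hφ : φ ∈ IsManifold.maximalAtlas (𝓡 n) ∞ M) (i j k : Fin n) {x : M} (hx : x ∈ φ.source) :
    christoffel D φ i j k x = gamma D φ (φ x) (stdVec k) (stdVec j) i := by
  unfold christoffel
  rw [coordComp_eq hφ _ _ hx, coordField_eq_ofLocal, coordField_eq_ofLocal,
    localRep_covD_ofLocal_const hφ D _ _ (φ.map_source hx)]

theorem partialD_comp_chart {φ : OpenPartialHomeomorph M (Coords n)}
    (hφ : φ ∈ IsManifold.maximalAtlas (𝓡 n) ∞ M) {g : Coords n → ℝ} {f : M → ℝ} {x : M}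
    (hx : x ∈ φ.source) (hf : f =ᶠ[𝓝 x] fun y ↦ g (φ y)) (hg : DifferentiableAt ℝ g (φ x))
    (i : Fin n) : partialD φ i f x = fderiv ℝ g (φ x) (stdVec i) := by
  unfold partialD
  rw [differential_congr hφ hf, differential_comp_chart hφ hx hg, mfderiv_chart_coordField hφ i hx]

/-- A closed multiplication defines a flow of the hierarchy. -/
theorem isHierarchyFlowOn_of_isMulOn (hD : D.torsion = 0) {U : Set M} (hU : IsOpen U)
    {V : EndField n M} (hV : SmoothEnd U V) (hmul : IsMulOn c e U V) (hc : IsExtClosedOn D V U) :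
    IsHierarchyFlowOn c D U V := by
  intro φ hφ
  have hVs := hV.contDiffOn hφ.1 hU
  have hentry : ∀ i j, ContDiffOn ℝ ∞ (fun u ↦ coordMatrix φ V u (stdVec j) i) (coordDomain φ U) :=
    fun i j ↦ (EuclideanSpace.proj (𝕜 := ℝ) i).contDiff.comp_contDiffOn
      (hVs.clm_apply contDiffOn_const)
  have hoff : ∀ u ∈ coordDomain φ U, ∀ j, coordMatrix φ V u (stdVec j) =
      coordMatrix φ V u (stdVec j) j • stdVec j := fun u hu j ↦ offdiag_of_isMulOn hφ hmul hu j
  refine ⟨fun i x ↦ coordMatrix φ V (φ x) (stdVec i) i, fun i ↦ ?_, fun i x hx ↦ ?_,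
    fun i j hij x hx ↦ ?_⟩
  · exact (hentry i i).contMDiffOn.comp
      ((contMDiffOn_of_mem_maximalAtlas hφ.1).mono Set.inter_subset_left)
      fun x hx ↦ mem_coordDomain hx.1 hx.2
  · have hu := mem_coordDomain hx.1 hx.2
    have h1 : V.app (coordField φ i) x =
        ((coordMatrix φ V (φ x) (stdVec i) i) • coordField φ i) x := by
      refine vfield_ext hφ.1 hx.1 fun k ↦ ?_
      rw [← coordMatrix_localRep hφ.1 _ _ hu.1, localRep_coordField hφ.1 _ hu.1]
      have h2 : localRep φ (coordMatrix φ V (φ x) (stdVec i) i • coordField φ i) (φ x) =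
          coordMatrix φ V (φ x) (stdVec i) i • localRep φ (coordField φ i) (φ x) :=
        map_smul (mfderiv (𝓡 n) (𝓡 n) φ (φ.symm (φ x))) _ _
      rw [h2, localRep_coordField hφ.1 _ hu.1]
      exact congrArg (fun w : Coords n ↦ w k) (hoff _ hu i)
    exact h1
  · have hu := mem_coordDomain hx.1 hx.2
    have hnh := (isOpen_coordDomain φ hU).mem_nhds hu
    have hVd : DifferentiableAt ℝ (coordMatrix φ V) (φ x) :=
      (hVs.contDiffAt hnh).differentiableAt (by simp)
    have hcol : ∀ (k l : Fin n) (b : Coords n), fderiv ℝ (fun u ↦ coordMatrix φ V u (stdVec k) l)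
        (φ x) b = fderiv ℝ (coordMatrix φ V) (φ x) b (stdVec k) l := by
      intro k l b
      have h1 : HasFDerivAt (fun u ↦ coordMatrix φ V u (stdVec k))
          ((fderiv ℝ (coordMatrix φ V) (φ x)).flip (stdVec k)) (φ x) := by
        simpa using hVd.hasFDerivAt.clm_apply (hasFDerivAt_const (stdVec k) (φ x))
      have h2 := ((EuclideanSpace.proj (𝕜 := ℝ) l).hasFDerivAt.comp (φ x) h1).fderiv
      exact congrArg (fun L ↦ L b) h2
    rw [partialD_comp_chart hφ.1 hx.1 (Filter.EventuallyEq.refl _ _)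
      (((hentry i i).contDiffAt hnh).differentiableAt (by simp)), hcol,
      christoffel_eq hφ.1 _ _ _ hx.1]
    have h3 : fderiv ℝ (coordMatrix φ V) (φ x) (stdVec i) (stdVec j) i = 0 := by
      rw [← hcol j i]
      have h4 : (fun u ↦ coordMatrix φ V u (stdVec j) i) =ᶠ[𝓝 (φ x)] fun _ ↦ 0 := by
        filter_upwards [hnh] with v hv
        rw [hoff v hv j]
        simp [hij]
      rw [h4.fderiv_eq]
      simp
    -- The `i`-th component of closedness on `∂_j, ∂_i`. For the diagonal field it reads `∂_j v^i +
    -- v^i Γ^i_{ij} = v^j Γ^i_{ij}`, because the off-diagonal entry in `h3` vanishes identically.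
    have h5 := congrArg (fun w : Coords n ↦ w i)
      (hc.fderiv_coordMatrix hφ.1 hU hV (stdVec j) (stdVec i) hu)
    simp only [PiLp.add_apply] at h5
    rw [h3, hoff _ hu i, hoff _ hu j, map_smul, map_smul, smul_apply, smul_apply, PiLp.smul_apply,
      PiLp.smul_apply, gamma_symm hφ.1 hD hu.1 (stdVec i) (stdVec j)] at h5
    simp only [smul_eq_mul] at h5
    linear_combination h5

/-- A flat connection compatible with a semisimple product is semi-Hamiltonian. -/
theorem isSemiHamiltonian_of_isFlat (hF : IsFManifold c e) (hD : IsCompatible c D)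
    (hflat : IsFlat D) : IsSemiHamiltonian c D := by
  intro φ hφ i j k hij hjk hki x hx
  have hu := φ.map_source hx
  have hd := diagonalIn_canonical hF hφ
  have hs := fun l ↦ smoothVF_coordField hφ.1 l
  -- The condition is the `k`-th component of `R(∂_i, ∂_k) ∂_j = 0`. Symbols with three distinct
  -- indices vanish, which removes `∂_k Γ^k_{ij}` and leaves four terms.
  have hR := hflat φ.source φ.open_source _ _ _ (hs i) (hs k) (hs j) x hx
  have hΓ := contDiffOn_gamma hφ.1 hD.smooth
  have hsymm : ∀ a b, gamma D φ (φ x) a b = gamma D φ (φ x) b a := gamma_symm hφ.1 hD.torsionless hu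
  have hzero : ∀ v ∈ φ.target, ∀ {l p q : Fin n}, p ≠ q → l ≠ p → l ≠ q →
      gamma D φ v (stdVec p) (stdVec q) l = 0 := fun v hv l p q hpq h1 h2 ↦
    (hD.localRep_gamma hφ.1 hd hF hpq hv l).1 h1 h2
  have hentry : ∀ p q l : Fin n, DifferentiableAt ℝ
      (fun v ↦ gamma D φ v (stdVec p) (stdVec q) l) (φ x) := fun p q l ↦
    (((EuclideanSpace.proj (𝕜 := ℝ) l).contDiff.comp_contDiffOn
      ((hΓ.clm_apply contDiffOn_const).clm_apply contDiffOn_const)).contDiffAt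
        (φ.open_target.mem_nhds hu)).differentiableAt (by simp)
  have hsec : ∀ p q : Fin n, localRep φ (covD D (coordField φ p)
      (covD D (coordField φ q) (coordField φ j))) (φ x) k =
      fderiv ℝ (fun v ↦ gamma D φ v (stdVec j) (stdVec q) k) (φ x) (stdVec p) +
        gamma D φ (φ x) (gamma D φ (φ x) (stdVec j) (stdVec q)) (stdVec p) k := by
    intro p q
    have hS := smoothVF_covD hD.smooth φ.open_source (hs q) (hs j)
    have hSd : DifferentiableAt ℝ (localRep φ (covD D (coordField φ q) (coordField φ j))) (φ x) :=
      ((hS.contDiffOn hφ.1).contDiffAt ((isOpen_coordDomain φ φ.open_source).mem_nhds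
        (mem_coordDomain hx hx))).differentiableAt (by simp)
    have hev : ∀ v ∈ φ.target, localRep φ (covD D (coordField φ q) (coordField φ j)) v =
      gamma D φ v (stdVec j) (stdVec q) := fun v hv ↦ localRep_covD_ofLocal_const hφ.1 D _ _ hv
    have h2 : fderiv ℝ (fun v ↦ localRep φ (covD D (coordField φ q) (coordField φ j)) v k) (φ x)
        = (EuclideanSpace.proj (𝕜 := ℝ) k).comp
          (fderiv ℝ (localRep φ (covD D (coordField φ q) (coordField φ j))) (φ x)) :=
      ((EuclideanSpace.proj (𝕜 := ℝ) k).hasFDerivAt.comp _ hSd.hasFDerivAt).fderiv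
    have h3 : (fun v ↦ localRep φ (covD D (coordField φ q) (coordField φ j)) v k) =ᶠ[𝓝 (φ x)]
        fun v ↦ gamma D φ v (stdVec j) (stdVec q) k :=
      Filter.eventually_of_mem (φ.open_target.mem_nhds hu) fun v hv ↦
        congrArg (fun w : Coords n ↦ w k) (hev v hv)
    rw [localRep_covD D hφ.1 φ.open_source hS _ (mem_coordDomain hx hx), hev _ hu,
      localRep_coordField hφ.1 _ hu, ← h3.fderiv_eq, h2]
    rfl
  have hR' : localRep φ (covD D (coordField φ i) (covD D (coordField φ k) (coordField φ j)) -
      covD D (coordField φ k) (covD D (coordField φ i) (coordField φ j)) -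
      covD D (bracket (coordField φ i) (coordField φ k)) (coordField φ j)) (φ x) = 0 :=
    localRep_eq_zero hφ.1 (by rw [φ.left_inv hx]; exact hR)
  have hbr : localRep φ (covD D (bracket (coordField φ i) (coordField φ k)) (coordField φ j))
      (φ x) = 0 := by
    rw [localRep_covD D hφ.1 φ.open_source (hs j) _ (mem_coordDomain hx hx), coordField_eq_ofLocal,
      coordField_eq_ofLocal, coordField_eq_ofLocal,
      localRep_bracket_ofLocal_const hφ.1 _ _ hu]
    simp
  rw [localRep_sub hφ.1, localRep_sub hφ.1, hbr, sub_zero] at hR'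
  have hk := congrArg (fun w : Coords n ↦ w k) hR'
  simp only [PiLp.sub_apply, PiLp.zero_apply] at hk
  rw [hsec, hsec] at hk
  have h0 : fderiv ℝ (fun v ↦ gamma D φ v (stdVec j) (stdVec i) k) (φ x) (stdVec k) = 0 := by
    have : (fun v ↦ gamma D φ v (stdVec j) (stdVec i) k) =ᶠ[𝓝 (φ x)] fun _ ↦ 0 :=
      Filter.eventually_of_mem (φ.open_target.mem_nhds hu)
        fun v hv ↦ hzero v hv hij.symm hjk.symm hki
    rw [this.fderiv_eq]; simp
  rw [h0, hD.gamma_component hφ.1 hd hF hki hu, hzero _ hu hjk hij hki.symm,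
    gamma_expand D φ _ (gamma D φ (φ x) (stdVec j) (stdVec i)) (stdVec k),
    Fintype.sum_eq_add i j hij (fun l hl ↦ by rw [hzero _ hu hij.symm hl.2 hl.1, zero_mul])] at hk
  rw [partialD_comp_chart hφ.1 hx (Filter.eventually_of_mem (φ.open_source.mem_nhds hx)
    fun y hy ↦ christoffel_eq hφ.1 k k j hy) (hentry j k k), christoffel_eq hφ.1 _ _ _ hx,
    christoffel_eq hφ.1 _ _ _ hx, christoffel_eq hφ.1 _ _ _ hx, christoffel_eq hφ.1 _ _ _ hx]
  rw [hsymm (stdVec i) (stdVec k)] at hk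
  linear_combination hk

theorem IsFlatFrameOn.mono {U W : Set M} {X : Fin n → VField n M} (h : IsFlatFrameOn D U X)
    (hWU : W ⊆ U) : IsFlatFrameOn D W X :=
  ⟨fun α ↦ (h.smooth α).mono hWU, fun α x hx ↦ h.flat α x (hWU hx), fun x hx ↦ h.frame x (hWU hx)⟩

theorem commuteOn_of_eq_zero {U : Set M} {V W : EndField n M} (h : ∀ x ∈ U, V x = 0) :
    CommuteOn U V W := fun x hx ↦ by
  rw [h x hx, ContinuousLinearMap.zero_comp, ContinuousLinearMap.comp_zero]

theorem CommuteOn.congr {U : Set M} {V V' W : EndField n M} (hV : CommuteOn U V W)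
    (h : ∀ x ∈ U, V' x = V x) : CommuteOn U V' W := fun x hx ↦ by
  rw [h x hx, hV x hx]

theorem IsTwistedChainOn.smooth {U : Set M} {X : ℕ → Fin n → VField n M}
    (hX : IsTwistedChainOn c E D₁ D₂ U X) (p : ℕ) (α : Fin n) : SmoothVF U (X p α) := by
  cases p with
  | zero => exact hX.start.smooth α
  | succ p => exact (hX.step p α).1

/-- If every step can be solved on `W` within a class of vector fields, then chains exist. -/
theorem exists_isTwistedChainOn {W : Set M} {X₀ : Fin n → VField n M}
    (hX₀ : IsFlatFrameOn D₁ W X₀) (P : VField n M → Prop) (h0 : ∀ α, P (X₀ α))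
    (hstep : ∀ X, P X → ∃ X', P X' ∧ IsTwistedStepOn c E D₁ D₂ W X X') :
    ∃ X : ℕ → Fin n → VField n M, X 0 = X₀ ∧ IsTwistedChainOn c E D₁ D₂ W X := by
  choose f hfP hf using hstep
  -- A next step is available only within the class `P`, so the iteration runs on the subtype.
  let next : {X // P X} → {X // P X} := fun X ↦ ⟨f X X.2, hfP X X.2⟩
  let chain : ℕ → Fin n → {X // P X} := fun p α ↦ next^[p] ⟨X₀ α, h0 α⟩
  refine ⟨fun p α ↦ (chain p α).1, rfl, ⟨hX₀, fun p α ↦ ?_⟩⟩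
  have : chain (p + 1) α = next (chain p α) := Function.iterate_succ_apply' next p _
  rw [this]
  exact hf _ _

end TwistedLenardMagri

end

/-! ### Assembly of the theorem -/

theorem mainTheorem1 (n : ℕ) (M : Type*) [TopologicalSpace M] [T2Space M]
    [ChartedSpace (EuclideanSpace ℝ (Fin n)) M] [IsManifold (𝓡 n) ∞ M]
    -- a semisimple `F`-manifold with eventual identity `E`
    (c : MulField n M) (e E Einv : VField n M)
    (hF : IsFManifold c e) (hss : IsSemisimple c)
    (hE : IsEventualIdentity c e E Einv) (hind : HasIndependentComponents c E)
    -- two almost hydrodynamically equivalent flat connections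
    (D₁ D₂ : Conn n M)
    (hD₁ : IsCompatible c D₁) (hD₂ : IsCompatible (dualMul c Einv) D₂)
    (hflat₁ : IsFlat D₁) (hflat₂ : IsFlat D₂)
    (heq : AlmostHydroEquiv c (dualMul c Einv) D₁ D₂) :
    -- the commutator condition is passed from `X` to `E ∘ X`, `d_{∇²} (E ∘ X)` is
    -- `d_{∇¹}`-closed, and every solution `X'` of the recursion satisfies the condition again
    (∀ U : Set M, IsOpen U → ∀ X : VField n M, SmoothVF U X →
      CommuteOn U (extD₀ D₁ X) (mulEnd c E) →
        CommuteOn U (extD₀ D₂ (mulVF c E X)) (mulEnd c E) ∧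
        IsExtClosedOn D₁ (extD₀ D₂ (mulVF c E X)) U ∧
        ∀ X' : VField n M, IsTwistedStepOn c E D₁ D₂ U X X' →
          CommuteOn U (extD₀ D₁ X') (mulEnd c E)) ∧
    -- the recursion started from a flat frame is well defined: near every point each step can
    -- be solved, and the whole chain exists on a common neighbourhood
    (∀ U : Set M, IsOpen U → ∀ X₀ : Fin n → VField n M, IsFlatFrameOn D₁ U X₀ →
      ∀ x ∈ U, ∃ W : Set M, IsOpen W ∧ x ∈ W ∧ W ⊆ U ∧
        (∀ X : VField n M, SmoothVF W X → CommuteOn W (extD₀ D₁ X) (mulEnd c E) →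
          ∃ X' : VField n M, IsTwistedStepOn c E D₁ D₂ W X X') ∧
        ∃ X : ℕ → Fin n → VField n M, X 0 = X₀ ∧ IsTwistedChainOn c E D₁ D₂ W X) ∧
    -- every chain produces commuting flows
    -- `u_{t_{(p+1,α)}} = d_{∇²} (E ∘ X_{(p,α)}) u_x = (d_{∇¹} X_{(p+1,α)}) u_x`
    -- of the semi-Hamiltonian hierarchy
    IsSemiHamiltonian c D₁ ∧
    (∀ U : Set M, IsOpen U → ∀ X : ℕ → Fin n → VField n M, IsTwistedChainOn c E D₁ D₂ U X →
      (∀ p α,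
        CommuteOn U (extD₀ D₁ (X p α)) (mulEnd c E) ∧
        CommuteOn U (extD₀ D₂ (mulVF c E (X p α))) (mulEnd c E) ∧
        IsExtClosedOn D₁ (extD₀ D₂ (mulVF c E (X p α))) U ∧
        IsHierarchyFlowOn c D₁ U (extD₀ D₁ (X (p + 1) α)) ∧
        IsHierarchyFlowOn c D₁ U (extD₀ D₂ (mulVF c E (X p α)))) ∧
      ∀ p q α β,
        FlowsCommuteOn U (extD₀ D₁ (X (p + 1) α)) (extD₀ D₁ (X (q + 1) β)) ∧
        FlowsCommuteOn U (extD₀ D₂ (mulVF c E (X p α))) (extD₀ D₂ (mulVF c E (X q β)))) := by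
  have hEU : ∀ U : Set M, SmoothVF U E := fun U ↦ hE.smooth.mono (Set.subset_univ U)
  have hmul : ∀ U : Set M, IsOpen U → ∀ X : VField n M, SmoothVF U X →
      CommuteOn U (extD₀ D₁ X) (mulEnd c E) → IsMulOn c e U (extD₀ D₂ (mulVF c E X)) :=
    fun U hU X hX hcomm ↦ isMulOn_extD₀_mulVF hF hss hE hind hD₁ hD₂ heq hU hX hcomm
  have hcomm₂ : ∀ U : Set M, IsOpen U → ∀ X : VField n M, SmoothVF U X →
      CommuteOn U (extD₀ D₁ X) (mulEnd c E) → CommuteOn U (extD₀ D₂ (mulVF c E X)) (mulEnd c E) :=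
    fun U hU X hX hcomm ↦ (hmul U hU X hX hcomm).commuteOn hF (isMulOn_mulEnd hF U E)
  have hsmooth : ∀ U : Set M, ∀ X : VField n M, SmoothVF U X →
      SmoothEnd U (extD₀ D₂ (mulVF c E X)) :=
    fun U X hX ↦ smoothEnd_extD₀ hD₂.smooth (smoothVF_mulVF hF (hEU U) hX)
  have hclosed : ∀ U : Set M, IsOpen U → ∀ X : VField n M, SmoothVF U X →
      CommuteOn U (extD₀ D₁ X) (mulEnd c E) → IsExtClosedOn D₁ (extD₀ D₂ (mulVF c E X)) U :=
    fun U hU X hX hcomm ↦ isExtClosedOn_extD₀ hF (heq.sameExtD hF hE) hD₂.smooth hflat₂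
      (smoothVF_mulVF hF (hEU U) hX) (hmul U hU X hX hcomm)
  have hnext : ∀ U : Set M, IsOpen U → ∀ X X' : VField n M, SmoothVF U X →
      CommuteOn U (extD₀ D₁ X) (mulEnd c E) → IsTwistedStepOn c E D₁ D₂ U X X' →
      CommuteOn U (extD₀ D₁ X') (mulEnd c E) :=
    fun U hU X X' hX hcomm hX' ↦ (hcomm₂ U hU X hX hcomm).congr hX'.2
  refine ⟨fun U hU X hX hcomm ↦ ⟨hcomm₂ U hU X hX hcomm, hclosed U hU X hX hcomm,
    fun X' hX' ↦ hnext U hU X X' hX hcomm hX'⟩, fun U hU X₀ hX₀ x hx ↦ ?_,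
    isSemiHamiltonian_of_isFlat hF hD₁ hflat₁, fun U hU X hX ↦ ?_⟩
  · obtain ⟨W, hW, hxW, hWU, hpot⟩ := exists_potential hU hX₀ hx
    have hsolve : ∀ X : VField n M, SmoothVF W X → CommuteOn W (extD₀ D₁ X) (mulEnd c E) →
        ∃ X' : VField n M, IsTwistedStepOn c E D₁ D₂ W X X' := fun X hX hcomm ↦
      hpot _ (hsmooth W X hX) (hclosed W hW X hX hcomm)
    refine ⟨W, hW, hxW, hWU, hsolve, ?_⟩
    -- The class is preserved by every step by `hnext`. The flat start belongs to it because `d_{∇¹}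
    -- X₀ = 0` commutes with everything.
    refine exists_isTwistedChainOn (hX₀.mono hWU)
      (fun X ↦ SmoothVF W X ∧ CommuteOn W (extD₀ D₁ X) (mulEnd c E))
      (fun α ↦ ⟨(hX₀.smooth α).mono hWU, commuteOn_of_eq_zero fun y hy ↦ hX₀.flat α y (hWU hy)⟩)
      fun X hX ↦ ?_
    obtain ⟨X', hX'⟩ := hsolve X hX.1 hX.2
    exact ⟨X', ⟨hX'.1, hnext W hW X X' hX.1 hX.2 hX'⟩, hX'⟩
  · have hc : ∀ p α, CommuteOn U (extD₀ D₁ (X p α)) (mulEnd c E) := by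
      intro p α
      induction p with
      | zero => exact commuteOn_of_eq_zero (hX.start.flat α)
      | succ p ih => exact hnext U hU _ _ (hX.smooth p α) ih (hX.step p α)
    have hm : ∀ p α, IsMulOn c e U (extD₀ D₂ (mulVF c E (X p α))) := fun p α ↦
      hmul U hU _ (hX.smooth p α) (hc p α)
    have hm' : ∀ p α, IsMulOn c e U (extD₀ D₁ (X (p + 1) α)) := fun p α ↦
      (hm p α).congr (hX.step p α).2
    have hs : ∀ p α, SmoothEnd U (extD₀ D₂ (mulVF c E (X p α))) := fun p α ↦
      hsmooth U _ (hX.smooth p α)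
    have hs' : ∀ p α, SmoothEnd U (extD₀ D₁ (X (p + 1) α)) := fun p α ↦
      smoothEnd_extD₀ hD₁.smooth (hX.smooth _ α)
    have hcl : ∀ p α, IsExtClosedOn D₁ (extD₀ D₂ (mulVF c E (X p α))) U := fun p α ↦
      hclosed U hU _ (hX.smooth p α) (hc p α)
    have hcl' : ∀ p α, IsExtClosedOn D₁ (extD₀ D₁ (X (p + 1) α)) U := by
      intro p α W hW hWU A B hA hB y hy
      -- The recursion identifies the two tensor fields on a whole open set, so closedness carries
      -- over.
      rw [extD₁_congr D₁ hW ((hs' p α).mono hWU) (fun z hz ↦ (hX.step p α).2 z (hWU hz)) hA hB hy]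
      exact hcl p α W hW hWU A B hA hB y hy
    refine ⟨fun p α ↦ ⟨hc p α, hcomm₂ U hU _ (hX.smooth p α) (hc p α), hcl p α,
      isHierarchyFlowOn_of_isMulOn hD₁.torsionless hU (hs' p α) (hm' p α) (hcl' p α),
      isHierarchyFlowOn_of_isMulOn hD₁.torsionless hU (hs p α) (hm p α) (hcl p α)⟩,
      fun p q α β ↦ ⟨?_, ?_⟩⟩
    · exact flowsCommuteOn_of_isExtClosedOn hD₁.torsionless hU (hs' p α) (hs' q β) (hcl' p α)
        (hcl' q β) ((hm' p α).commuteOn hF (hm' q β))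
    · exact flowsCommuteOn_of_isExtClosedOn hD₁.torsionless hU (hs p α) (hs q β) (hcl p α)
        (hcl q β) ((hm p α).commuteOn hF (hm q β))
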